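/- Let $I=[0,1]$ with Borel $\sigma$-algebra $\mathcal B$ and Lebesgue measure $m$. Let $\mathcal T$ be the class of (Borel measurable) maps $\tau:I\to I$ for which there is a countably infinite family of nonempty, pairwise disjoint open intervals $I_i=(a_i,b_i)\subset I$, $i\ge 1$, with $m\big(I\setminus\bigcup_{i}I_i\big)=0$, such that: 1. for every $i$ the restriction $\tau_i=\tau|_{I_i}$ is strictly increasing, convex and differentiable, with $\lim_{x\to a_i^+}\tau_i(x)=0$; 2. with $\tau_i'(a_i):=\lim_{x\to a_i^+}\tau_i'(x)$, all $\tau_i'(a_i)$ are positive and $\sum_{i\ge1}\frac{1}{\tau_i'(a_i)}<+\infty$; 3. if $0$ is not a limit point of the set $\{a_i\}\cup\{b_i\}$ of partition points (so that $a_i=0$ for some $i$), then $\tau'(0):=\tau_i'(a_i)>1$ for that $i$. Let $\tau\in\mathcal T$. Then there is a unique absolutely continuous (with respect to $m$) $\tau$-invariant probability measure $\mu$ on $(I,\mathcal B)$. The system $(I,\mathcal B,\mu,\tau)$ is exact, i.e. every $A\in\bigcap_{n\ge0}\tau^{-n}(\mathcal B)$ satisfies $\mu(A)\in\{0,1\}$,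 and the density $h=\frac{d\mu}{dm}$ has a version that is bounded and non-increasing on $I$. -/

import Mathlib

open MeasureTheory Set Filter Topology

/-- The real-variable form of a self-map `τ` of `[0, 1]`: it agrees with `τ` on `[0, 1]` and is
extended by constants outside.  Only its values inside `[0, 1]` matter below. -/
noncomputable def realMap (τ : unitInterval → unitInterval) : ℝ → ℝ :=
  IccExtend (zero_le_one (α := ℝ)) fun x => (τ x : ℝ)

/-- `τ` is a piecewise convex map of `I = [0, 1]` with the countably infinite family of branch
domains `(a i, b i)`, where `s i` is the value at `a i`, by right continuity, of the derivative of
the `i`-th branch. -/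
structure IsPiecewiseConvexMap (τ : unitInterval → unitInterval) (a b s : ℕ → ℝ) : Prop where
  measurable : Measurable τ
  nonneg_left : ∀ i, 0 ≤ a i
  left_lt_right : ∀ i, a i < b i
  right_le_one : ∀ i, b i ≤ 1
  disjoint : Pairwise fun i j => Disjoint (Ioo (a i) (b i)) (Ioo (a j) (b j))
  null_compl : volume (Icc (0 : ℝ) 1 \ ⋃ i, Ioo (a i) (b i)) = 0
  strictMonoOn : ∀ i, StrictMonoOn (realMap τ) (Ioo (a i) (b i))
  convexOn : ∀ i, ConvexOn ℝ (Ioo (a i) (b i)) (realMap τ)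
  differentiableOn : ∀ i, DifferentiableOn ℝ (realMap τ) (Ioo (a i) (b i))
  tendsto_left : ∀ i, Tendsto (realMap τ) (𝓝[>] a i) (𝓝 0)
  tendsto_deriv : ∀ i, Tendsto (deriv (realMap τ)) (𝓝[>] a i) (𝓝 (s i))
  /-- The slopes `s i ≥ 0` do not vanish: otherwise `∑ 1 / s i` would have an infinite term. -/
  slope_pos : ∀ i, 0 < s i
  summable_inv_slope : Summable fun i => 1 / s i
  /-- If `0` is not a limit point of the partition points, then it is the left end point of one of
  the intervals, and the derivative there exceeds one. -/
  one_lt_slope_zero : ¬ AccPt (0 : ℝ) (𝓟 (range a ∪ range b)) → ∀ i, a i = 0 → 1 < s i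

/-- The class of piecewise convex maps of `[0, 1]` with countably infinitely many branches. -/
def classT : Set (unitInterval → unitInterval) :=
  {τ | ∃ a b s : ℕ → ℝ, IsPiecewiseConvexMap τ a b s}

/-- `μ` is a normalized absolutely continuous `τ`-invariant measure on `[0, 1]`. -/
structure IsNormalizedACIM (τ : unitInterval → unitInterval) (μ : Measure unitInterval) :
    Prop where
  isProbabilityMeasure : IsProbabilityMeasure μ
  absolutelyContinuous : μ ≪ (volume : Measure unitInterval)
  measurePreserving : MeasurePreserving τ μ μ

/-- The measure preserving system `(X, μ, τ)`, with `μ` a probability measure, is exact: every set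
of the tail `σ`-algebra `⋂ n, τ⁻ⁿ(𝓑)` has measure `0` or `1`. -/
structure IsExactSystem {X : Type*} [MeasurableSpace X] (τ : X → X) (μ : Measure X) : Prop where
  isProbabilityMeasure : IsProbabilityMeasure μ
  measurePreserving : MeasurePreserving τ μ μ
  tail_trivial : ∀ A : Set X, (∀ n : ℕ, ∃ B : Set X, MeasurableSet B ∧ A = τ^[n] ⁻¹' B) →
    μ A = 0 ∨ μ A = 1

/-! A bounded non-increasing density amounts to a distribution function that is concave on `[0, ∞)`
and bounded by `L * x`. Push-forward by `τ` preserves this class, since an increasing convex branch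
starting at height `0` has a concave inverse. The bound `L` behaves as in a Lasota–Yorke inequality.
A branch of initial slope `s` contributes at most `L / s`; if its left end `a` is positive it also
contributes at most mass `/ (a * s)`, because a concave distribution function has slope at most mass
`/ a` beyond `a`. At most one branch starts at `0`, with slope above `1`, and `∑ 1 / s i` converges.
Using the second bound on finitely many branches therefore turns `L` into `α * L + K * mass` with `α
< 1` (`exists_hasConcaveDistFun_map`), and iteration brings `L` below `C * mass`. Existence follows
by taking a limit of Cesàro averages of the images of Lebesgue measure, and concavity of the limit
gives the monotone density. For exactness, a measure of mass `M` with bound `C * M` has density at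
least `M / 2` on `[0, 1 / (2 * C)]` (`smul_restrict_le`). Itineraries separate points
(`not_forall_iterate_mem`), so a non-null set almost fills some cylinder; if it is a tail set, its
images almost fill `[0, 1 / (2 * C)]`. A tail set and its complement cannot both do so. Exactness
gives ergodicity, hence uniqueness. -/

/-! ### Distribution functions and comparison of measures. -/

/-- The distribution function of a measure on `[0, 1]`, as a function of a real variable. -/
noncomputable def distFun (ν : Measure unitInterval) (x : ℝ) : ℝ :=
  ν.real {y | (y : ℝ) ≤ x}

theorem measurableSet_coe_le (x : ℝ) : MeasurableSet {y : unitInterval | (y : ℝ) ≤ x} :=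
  measurableSet_le measurable_subtype_coe measurable_const

section distFun

variable (ν : Measure unitInterval)

theorem distFun_nonneg (x : ℝ) : 0 ≤ distFun ν x := measureReal_nonneg

theorem distFun_of_one_le {x : ℝ} (hx : 1 ≤ x) : distFun ν x = ν.real univ := by
  unfold distFun
  congr 1
  ext y
  simpa using y.2.2.trans hx

theorem distFun_of_neg {x : ℝ} (hx : x < 0) : distFun ν x = 0 := by
  have : {y : unitInterval | (y : ℝ) ≤ x} = ∅ := by
    ext y
    simpa using hx.trans_le y.2.1
  simp [distFun, this]

theorem apply_eq_map_coe_image (s : Set unitInterval) :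
    ν s = ν.map ((↑) : unitInterval → ℝ) ((↑) '' s) := by
  rw [unitInterval.measurableEmbedding_coe.map_apply,
    preimage_image_eq _ Subtype.val_injective]

variable [IsFiniteMeasure ν]

theorem distFun_mono : Monotone (distFun ν) := fun _ _ h =>
  measureReal_mono fun _ hy => le_trans hy h

theorem distFun_le (x : ℝ) : distFun ν x ≤ ν.real univ := measureReal_mono (subset_univ _)

theorem distFun_sub {u v : ℝ} (h : u ≤ v) :
    distFun ν v - distFun ν u = ν.real {y | u < (y : ℝ) ∧ (y : ℝ) ≤ v} := by
  unfold distFun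
  have hsub : {y : unitInterval | (y : ℝ) ≤ u} ⊆ {y | (y : ℝ) ≤ v} := fun _ hy => le_trans hy h
  rw [← measureReal_sdiff hsub (measurableSet_coe_le u)]
  congr 1
  ext y
  simp [and_comm]

theorem map_coe_Ioc {u v : ℝ} (h : u ≤ v) :
    ν.map ((↑) : unitInterval → ℝ) (Ioc u v) = ENNReal.ofReal (distFun ν v - distFun ν u) := by
  rw [Measure.map_apply measurable_subtype_coe measurableSet_Ioc, distFun_sub ν h,
    ofReal_measureReal]
  rfl

end distFun

/-- Two finite measures on `[0, 1]` are comparable as soon as the difference of their distribution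
functions is continuous and monotone. -/
theorem measure_le_of_monotone_distFun_sub (ν₁ ν₂ : Measure unitInterval) [IsFiniteMeasure ν₁]
    [IsFiniteMeasure ν₂] (hm : Monotone fun x => distFun ν₂ x - distFun ν₁ x)
    (hc : Continuous fun x => distFun ν₂ x - distFun ν₁ x) : ν₁ ≤ ν₂ := by
  let D : StieltjesFunction ℝ :=
    ⟨fun x => distFun ν₂ x - distFun ν₁ x, hm, fun x => hc.continuousWithinAt⟩
  have key : ν₂.map ((↑) : unitInterval → ℝ) = ν₁.map (↑) + D.measure := by
    refine Measure.ext_of_Ioc _ _ fun u v huv => ?_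
    rw [Measure.add_apply, map_coe_Ioc _ huv.le, map_coe_Ioc _ huv.le, D.measure_Ioc,
      ← ENNReal.ofReal_add (sub_nonneg.2 (distFun_mono _ huv.le)) (sub_nonneg.2 (hm huv.le))]
    congr 1
    change _ = _ + ((distFun ν₂ v - distFun ν₁ v) - (distFun ν₂ u - distFun ν₁ u))
    ring
  refine Measure.le_iff'.2 fun s => ?_
  rw [apply_eq_map_coe_image, apply_eq_map_coe_image, key]
  exact le_self_add

/-! ### Measures with concave distribution function. -/

/-- The distribution function of `ν` is concave on `[0, ∞)`, and bounded by `L * x`. -/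
structure HasConcaveDistFun (ν : Measure unitInterval) (L : ℝ) : Prop where
  concaveOn : ConcaveOn ℝ (Ici 0) (distFun ν)
  le_mul : ∀ x, 0 ≤ x → distFun ν x ≤ L * x

namespace HasConcaveDistFun

variable {ν : Measure unitInterval} {L : ℝ}

theorem mono_right (h : HasConcaveDistFun ν L) {L' : ℝ} (hL : L ≤ L') : HasConcaveDistFun ν L' :=
  ⟨h.concaveOn, fun x hx => (h.le_mul x hx).trans (mul_le_mul_of_nonneg_right hL hx)⟩

theorem real_univ_le (h : HasConcaveDistFun ν L) : ν.real univ ≤ L := by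
  have := h.le_mul 1 zero_le_one
  rwa [distFun_of_one_le ν le_rfl, mul_one] at this

theorem nonneg (h : HasConcaveDistFun ν L) : 0 ≤ L := measureReal_nonneg.trans h.real_univ_le

theorem apply_zero (h : HasConcaveDistFun ν L) : distFun ν 0 = 0 :=
  le_antisymm (by simpa using h.le_mul 0 le_rfl) (distFun_nonneg ν 0)

theorem apply_of_nonpos (h : HasConcaveDistFun ν L) {x : ℝ} (hx : x ≤ 0) : distFun ν x = 0 :=
  hx.lt_or_eq.elim (distFun_of_neg ν) fun e => e ▸ h.apply_zero

/-- Chords from the origin flatten to the right. This is what controls the slope away from `0` by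
the mass instead of by `L`. -/
theorem sub_le_div_mul (h : HasConcaveDistFun ν L) {u v : ℝ} (hu : 0 < u) (huv : u ≤ v) :
    distFun ν v - distFun ν u ≤ distFun ν u / u * (v - u) := by
  have hv : 0 < v := hu.trans_le huv
  have := h.concaveOn.2 (mem_Ici.2 le_rfl) (mem_Ici.2 hv.le)
    (sub_nonneg.2 ((div_le_one hv).2 huv)) (div_nonneg hu.le hv.le) (by ring)
  simp only [smul_eq_mul, mul_zero, zero_add, h.apply_zero] at this
  rw [div_mul_cancel₀ _ hv.ne', div_mul_eq_mul_div, div_le_iff₀ hv] at this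
  rw [div_mul_eq_mul_div, le_div_iff₀ hu]
  linarith

theorem sub_le_mul (h : HasConcaveDistFun ν L) {u v : ℝ} (huv : u ≤ v) :
    distFun ν v - distFun ν u ≤ L * (v - u) := by
  rcases lt_or_ge 0 u with hu | hu
  · refine (h.sub_le_div_mul hu huv).trans (mul_le_mul_of_nonneg_right ?_ (sub_nonneg.2 huv))
    exact (div_le_iff₀ hu).2 (h.le_mul u hu.le)
  · rw [h.apply_of_nonpos hu, sub_zero]
    rcases le_or_gt v 0 with hv | hv
    · rw [h.apply_of_nonpos hv]
      exact mul_nonneg h.nonneg (sub_nonneg.2 huv)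
    · exact (h.le_mul v hv.le).trans (mul_le_mul_of_nonneg_left (by linarith) h.nonneg)

variable [IsFiniteMeasure ν]

theorem sub_le_div_mul_real_univ (h : HasConcaveDistFun ν L) {u v : ℝ} (hu : 0 < u) (huv : u ≤ v) :
    distFun ν v - distFun ν u ≤ ν.real univ / u * (v - u) :=
  (h.sub_le_div_mul hu huv).trans <| mul_le_mul_of_nonneg_right
    (div_le_div_of_nonneg_right (distFun_le ν u) hu.le) (sub_nonneg.2 huv)

theorem continuous (h : HasConcaveDistFun ν L) : Continuous (distFun ν) := by
  have : LipschitzWith L.toNNReal (distFun ν) := by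
    refine LipschitzWith.of_le_add_mul _ fun x y => ?_
    rw [Real.coe_toNNReal _ h.nonneg, Real.dist_eq]
    rcases le_total x y with hxy | hxy
    · have := distFun_mono ν hxy
      have := mul_nonneg h.nonneg (abs_nonneg (x - y))
      linarith
    · rw [abs_of_nonneg (sub_nonneg.2 hxy)]
      linarith [h.sub_le_mul hxy]
  exact this.continuous

theorem real_singleton (h : HasConcaveDistFun ν L) (x : ℝ) : ν.real {y | (y : ℝ) = x} = 0 := by
  refine le_antisymm (le_of_forall_pos_le_add fun e he => ?_) measureReal_nonneg
  have hL : 0 < L + 1 := by linarith [h.nonneg]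
  have h1 : x - e / (L + 1) ≤ x := sub_le_self _ (by positivity)
  have h2 := h.sub_le_mul h1
  rw [distFun_sub ν h1, sub_sub_cancel] at h2
  have h3 : L * (e / (L + 1)) ≤ 0 + e := by
    rw [zero_add, mul_div_assoc', div_le_iff₀ hL]
    nlinarith
  have hsub : {y : unitInterval | (y : ℝ) = x} ⊆ {y | x - e / (L + 1) < (y : ℝ) ∧ (y : ℝ) ≤ x} := by
    intro y (hy : (y : ℝ) = x)
    simp only [mem_ofPred_eq, hy, le_refl, and_true, sub_lt_self_iff]
    positivity
  exact (measureReal_mono hsub).trans (h2.trans h3)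

end HasConcaveDistFun

theorem distFun_smul (ν : Measure unitInterval) {c : ℝ} (hc : 0 ≤ c) (x : ℝ) :
    distFun (ENNReal.ofReal c • ν) x = c * distFun ν x := by
  simp [distFun, measureReal_def, hc]

theorem distFun_volume_restrict {e : ℝ} (he1 : e ≤ 1) (x : ℝ) :
    distFun ((volume : Measure unitInterval).restrict {y | (y : ℝ) ≤ e}) x
      = max 0 (min x e) := by
  have h : (Subtype.val '' ({y : unitInterval | (y : ℝ) ≤ x} ∩ {y | (y : ℝ) ≤ e}))
      = Icc 0 (min x e) := by
    ext z
    simp only [mem_image, mem_inter_iff, mem_ofPred_eq, mem_Icc, le_min_iff]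
    constructor
    · rintro ⟨y, hy, rfl⟩
      exact ⟨y.2.1, hy⟩
    · rintro ⟨h0, hy⟩
      exact ⟨⟨z, h0, hy.2.trans he1⟩, hy, rfl⟩
  rw [distFun, measureReal_restrict_apply (measurableSet_coe_le x), measureReal_def,
    unitInterval.volume_apply, h, Real.volume_Icc, sub_zero, ENNReal.toReal_ofReal', max_comm]

theorem distFun_volume (x : ℝ) : distFun (volume : Measure unitInterval) x = max 0 (min x 1) := by
  rw [← distFun_volume_restrict le_rfl]
  have : {y : unitInterval | (y : ℝ) ≤ 1} = univ := eq_univ_of_forall fun y => y.2.2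
  rw [this, Measure.restrict_univ]

theorem hasConcaveDistFun_volume : HasConcaveDistFun volume 1 := by
  constructor
  · have : ConcaveOn ℝ (Ici (0 : ℝ)) fun x => min x 1 :=
      (concaveOn_id (convex_Ici 0)).inf (concaveOn_const 1 (convex_Ici 0))
    refine this.congr fun x hx => ?_
    rw [distFun_volume, max_eq_right (le_min hx zero_le_one)]
  · intro x hx
    rw [distFun_volume, max_eq_right (le_min hx zero_le_one), one_mul]
    exact min_le_left _ _

namespace HasConcaveDistFun

variable {ν : Measure unitInterval} [IsFiniteMeasure ν] {L : ℝ}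

theorem le_smul_volume (h : HasConcaveDistFun ν L) : ν ≤ ENNReal.ofReal L • volume := by
  have hfin : IsFiniteMeasure (ENNReal.ofReal L • (volume : Measure unitInterval)) :=
    Measure.smul_finite _ ENNReal.ofReal_ne_top
  refine measure_le_of_monotone_distFun_sub _ _ (fun u v huv => ?_) ?_
  · simp only [distFun_smul _ h.nonneg, distFun_volume]
    rcases le_or_gt v 0 with hv | hv
    · rw [h.apply_of_nonpos hv, h.apply_of_nonpos (huv.trans hv),
        max_eq_left ((min_le_left u 1).trans (huv.trans hv)), max_eq_left ((min_le_left v 1).trans hv)]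
    rcases le_or_gt 1 u with hu | hu
    · rw [distFun_of_one_le ν hu, distFun_of_one_le ν (hu.trans huv), min_eq_right hu,
        min_eq_right (hu.trans huv)]
    have hFv : distFun ν v ≤ distFun ν (min v 1) := by
      rcases le_total v 1 with h1 | h1
      · rw [min_eq_left h1]
      · rw [min_eq_right h1, distFun_of_one_le ν h1, distFun_of_one_le ν le_rfl]
    have hFu : distFun ν (max 0 u) ≤ distFun ν u := by
      rcases le_total 0 u with h1 | h1
      · rw [max_eq_right h1]
      · rw [max_eq_left h1, h.apply_zero]
        exact distFun_nonneg ν u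
    have := h.sub_le_mul (u := max 0 u) (v := min v 1)
      (le_min (max_le hv.le huv) (max_le zero_le_one hu.le))
    rw [min_eq_left hu.le, max_eq_right (le_min hv.le zero_le_one)]
    linarith
  · simp only [distFun_smul _ h.nonneg, distFun_volume]
    have := h.continuous
    fun_prop

theorem absolutelyContinuous (h : HasConcaveDistFun ν L) : ν ≪ volume :=
  (Measure.absolutelyContinuous_of_le h.le_smul_volume).trans
    Measure.smul_absolutelyContinuous

theorem real_le (h : HasConcaveDistFun ν L) (s : Set unitInterval) :
    ν.real s ≤ L * volume.real s := by
  have hfin : IsFiniteMeasure (ENNReal.ofReal L • (volume : Measure unitInterval)) :=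
    Measure.smul_finite _ ENNReal.ofReal_ne_top
  have := ENNReal.toReal_mono (measure_ne_top _ _) (h.le_smul_volume s)
  simpa [measureReal_def, h.nonneg] using this

/-- A measure of mass `M` with concave distribution function of slope at most `C * M` has density
at least `M / 2` near `0`. -/
theorem smul_restrict_le {C : ℝ} (hC : 1 ≤ C) (h : HasConcaveDistFun ν (C * ν.real univ)) :
    ENNReal.ofReal (ν.real univ / 2) • volume.restrict {y : unitInterval | (y : ℝ) ≤ 1 / (2 * C)}
      ≤ ν := by
  set M := ν.real univ
  set e := 1 / (2 * C)
  have hM : 0 ≤ M := measureReal_nonneg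
  have hM2 : 0 ≤ M / 2 := by positivity
  have he : 0 < e := by positivity
  have hCe : C * e = 1 / 2 := by simp only [e]; field_simp
  have he1 : e ≤ 1 / 2 := by nlinarith
  have hfin : IsFiniteMeasure (ENNReal.ofReal (M / 2) •
      (volume : Measure unitInterval).restrict {y | (y : ℝ) ≤ e}) :=
    Measure.smul_finite _ ENNReal.ofReal_ne_top
  -- On `[0, e]` at most `C * M * e = M / 2` of the mass has been used, so the chord from `v` to `1`
  -- has slope at least `M / 2`; by concavity the chords to its left are at least as steep.
  have hslope : ∀ u v, 0 ≤ u → u < v → v ≤ e → M / 2 * (v - u) ≤ distFun ν v - distFun ν u := by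
    intro u v hu huv hve
    have h1 := h.concaveOn.slope_anti_adjacent (mem_Ici.2 hu) (mem_Ici.2 zero_le_one) huv
      (by linarith)
    rw [le_div_iff₀ (by linarith)] at h1
    refine le_trans (mul_le_mul_of_nonneg_right ?_ (by linarith)) h1
    have hv := h.le_mul v (hu.trans huv.le)
    rw [distFun_of_one_le ν le_rfl, le_div_iff₀ (by linarith)]
    have h3 : C * M * v ≤ M * (1 / 2) := by
      rw [← hCe]; nlinarith [mul_nonneg (by linarith : 0 ≤ C) hM]
    change M / 2 * (1 - v) ≤ M - distFun ν v
    nlinarith [mul_nonneg hM (hu.trans huv.le)]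
  refine measure_le_of_monotone_distFun_sub _ _ (fun u v huv => ?_) ?_
  · simp only [distFun_smul _ (hM2), distFun_volume_restrict (by linarith : e ≤ 1)]
    have hp : max 0 (min u e) ≤ max 0 (min v e) := max_le_max le_rfl (min_le_min huv le_rfl)
    rcases hp.eq_or_lt with heq | hlt
    · rw [heq]
      exact sub_le_sub_right (distFun_mono ν huv) _
    · have hv : max 0 (min v e) = min v e :=
        max_eq_right (le_of_not_ge fun hn => by
          rw [max_eq_left hn] at hlt
          exact (le_max_left _ _).not_gt hlt)
      rw [hv] at hlt ⊢
      have hu : u ≤ max 0 (min u e) := by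
        rcases min_choice u e with hc | hc
        · rw [hc]; exact le_max_right _ _
        · rw [hc] at hlt
          exact absurd (hlt.trans_le (min_le_right v e)) (le_max_right _ _).not_gt
      have := hslope _ _ (le_max_left _ _) hlt (min_le_right v e)
      have := distFun_mono ν hu
      have := distFun_mono ν (min_le_left v e)
      linarith
  · have := h.continuous
    simp only [distFun_smul _ (hM2), distFun_volume_restrict (by linarith : e ≤ 1)]
    fun_prop

end HasConcaveDistFun

/-! ### Convex branches and their concave inverses. -/

/-- `f` is an increasing convex branch on `(a, b)`, starting at `0` with slope `s`. -/
structure IsConvexBranch (f : ℝ → ℝ) (a b s : ℝ) : Prop where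
  lt : a < b
  strictMonoOn : StrictMonoOn f (Ioo a b)
  convexOn : ConvexOn ℝ (Ioo a b) f
  differentiableOn : DifferentiableOn ℝ f (Ioo a b)
  tendsto_left : Tendsto f (𝓝[>] a) (𝓝 0)
  tendsto_deriv : Tendsto (deriv f) (𝓝[>] a) (𝓝 s)
  slope_pos : 0 < s

namespace IsConvexBranch

variable {f : ℝ → ℝ} {a b s : ℝ} (h : IsConvexBranch f a b s)

include h

theorem nonneg {y : ℝ} (hy : y ∈ Ioo a b) : 0 ≤ f y := by
  refine le_of_tendsto h.tendsto_left ?_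
  filter_upwards [Ioo_mem_nhdsGT hy.1] with w hw
  exact (h.strictMonoOn ⟨hw.1, hw.2.trans hy.2⟩ hy hw.2).le

theorem pos {y : ℝ} (hy : y ∈ Ioo a b) : 0 < f y := by
  obtain ⟨w, hw⟩ := exists_between hy.1
  have hw' : w ∈ Ioo a b := ⟨hw.1, hw.2.trans hy.2⟩
  exact (h.nonneg hw').trans_lt (h.strictMonoOn hw' hy hw.2)

/-- The secant of a branch from its left end point is steeper to the right. -/
theorem secant_mul_le {u v : ℝ} (hu : a < u) (huv : u ≤ v) (hv : v < b) :
    f u * (v - a) ≤ f v * (u - a) := by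
  rcases huv.eq_or_lt with rfl | huv
  · exact le_rfl
  have hlim : Tendsto (fun w => f u * (v - w) - ((v - u) * f w + (u - w) * f v)) (𝓝[>] a)
      (𝓝 (f u * (v - a) - ((v - u) * 0 + (u - a) * f v))) := by
    have hid : Tendsto (fun w : ℝ => w) (𝓝[>] a) (𝓝 a) := tendsto_id.mono_left nhdsWithin_le_nhds
    exact ((hid.const_sub v).const_mul _).sub
      ((h.tendsto_left.const_mul _).add ((hid.const_sub u).mul_const _))
  have : f u * (v - a) - ((v - u) * 0 + (u - a) * f v) ≤ 0 := by
    refine le_of_tendsto hlim ?_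
    filter_upwards [Ioo_mem_nhdsGT hu] with w hw
    have := h.convexOn.slope_mono_adjacent ⟨hw.1, hw.2.trans (huv.trans hv)⟩ ⟨hu.trans huv, hv⟩
      hw.2 huv
    rw [div_le_div_iff₀ (sub_pos.2 hw.2) (sub_pos.2 huv)] at this
    linarith
  linarith

theorem slope_mul_le {y : ℝ} (hy : y ∈ Ioo a b) : s * (y - a) ≤ f y := by
  have hid : Tendsto (fun w : ℝ => w) (𝓝[>] a) (𝓝 a) := tendsto_id.mono_left nhdsWithin_le_nhds
  have hlim : Tendsto (fun w => deriv f w * (y - w)) (𝓝[>] a) (𝓝 (s * (y - a))) :=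
    h.tendsto_deriv.mul (hid.const_sub y)
  refine le_of_tendsto hlim ?_
  filter_upwards [Ioo_mem_nhdsGT hy.1] with w hw
  have hw' : w ∈ Ioo a b := ⟨hw.1, hw.2.trans hy.2⟩
  have := h.convexOn.deriv_le_slope hw' hy hw.2
    ((h.differentiableOn w hw').differentiableAt (Ioo_mem_nhds hw'.1 hw'.2))
  rw [slope_def_field, le_div_iff₀ (sub_pos.2 hw.2)] at this
  linarith [h.nonneg hw']

theorem tendsto_update_add {x : ℝ} (hx : x ∈ Ico a b) :
    Tendsto (fun e => Function.update f a 0 (x + e)) (𝓝[>] 0)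
      (𝓝 (Function.update f a 0 x)) := by
  have hadd : Tendsto (fun e => x + e) (𝓝[>] 0) (𝓝[>] x) := by
    refine tendsto_nhdsWithin_iff.2 ⟨?_, ?_⟩
    · have : Tendsto (fun e => x + e) (𝓝 0) (𝓝 (x + 0)) := (continuous_const_add x).tendsto 0
      rw [add_zero] at this
      exact this.mono_left nhdsWithin_le_nhds
    · filter_upwards [self_mem_nhdsWithin] with e he
      exact lt_add_of_pos_right x he
  have hf : Tendsto f (𝓝[>] x) (𝓝 (Function.update f a 0 x)) := by
    rcases hx.1.eq_or_lt with rfl | hax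
    · rw [Function.update_self]
      exact h.tendsto_left
    · rw [Function.update_of_ne hax.ne']
      exact ((h.differentiableOn x ⟨hax, hx.2⟩).differentiableAt
        (Ioo_mem_nhds hax hx.2)).continuousAt.tendsto.mono_left nhdsWithin_le_nhds
  refine (hf.comp hadd).congr' ?_
  filter_upwards [self_mem_nhdsWithin] with e he
  have he : 0 < e := he
  rw [Function.comp_apply, Function.update_of_ne (by linarith [hx.1] : x + e ≠ a)]

/-- Shifting the points right by `e` puts them in the open interval, where convexity is given; right
continuity lets `e` tend to `0`. -/
theorem convexOn_update : ConvexOn ℝ (Ico a b) (Function.update f a 0) := by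
  refine ⟨convex_Ico a b, fun x hx y hy t r ht hr htr => ?_⟩
  have hz : t • x + r • y ∈ Ico a b := convex_Ico a b hx hy ht hr htr
  refine le_of_tendsto_of_tendsto (h.tendsto_update_add hz)
    (((h.tendsto_update_add hx).const_smul t).add ((h.tendsto_update_add hy).const_smul r)) ?_
  have hb : ∀ z ∈ Ico a b, ∀ᶠ e in 𝓝[>] (0 : ℝ), z + e ∈ Ioo a b := by
    intro z hz
    filter_upwards [Ioo_mem_nhdsGT (sub_pos.2 hz.2)] with e he
    exact ⟨by linarith [hz.1, he.1], by linarith [he.2]⟩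
  filter_upwards [hb _ hx, hb _ hy, hb _ hz] with e hxe hye hze
  rw [Function.update_of_ne hxe.1.ne', Function.update_of_ne hye.1.ne',
    Function.update_of_ne hze.1.ne']
  have := h.convexOn.2 hxe hye ht hr htr
  convert this using 2
  simp only [smul_eq_mul]
  linear_combination (-e) * htr

end IsConvexBranch

/-- The inverse of the branch of `f` on `(a, b)`, extended by a constant to the right of its
range. -/
noncomputable def branchInv (f : ℝ → ℝ) (a b x : ℝ) : ℝ :=
  sSup {y | y ∈ Ico a b ∧ Function.update f a 0 y ≤ x}

namespace IsConvexBranch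

variable {f : ℝ → ℝ} {a b s : ℝ} (h : IsConvexBranch f a b s)

theorem bddAbove_branchInv (f : ℝ → ℝ) (a b x : ℝ) :
    BddAbove {y | y ∈ Ico a b ∧ Function.update f a 0 y ≤ x} :=
  ⟨b, fun _ hy => hy.1.2.le⟩

theorem le_branchInv {f : ℝ → ℝ} {a b x y : ℝ} (hy : y ∈ Ioo a b) (hx : f y ≤ x) : y ≤ branchInv f a b x :=
  le_csSup (bddAbove_branchInv f a b x)
    ⟨Ioo_subset_Ico_self hy, by rwa [Function.update_of_ne hy.1.ne']⟩

include h

theorem left_mem_branchInv {x : ℝ} (hx : 0 ≤ x) :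
    a ∈ {y | y ∈ Ico a b ∧ Function.update f a 0 y ≤ x} :=
  ⟨left_mem_Ico.2 h.lt, by rwa [Function.update_self]⟩

theorem left_le_branchInv {x : ℝ} (hx : 0 ≤ x) : a ≤ branchInv f a b x :=
  le_csSup (bddAbove_branchInv f a b x) (h.left_mem_branchInv hx)

theorem apply_le_of_lt_branchInv {x y : ℝ} (hx : 0 ≤ x) (hy : a < y)
    (hyx : y < branchInv f a b x) : y < b ∧ f y ≤ x := by
  obtain ⟨z, ⟨hz, hzx⟩, hyz⟩ := exists_lt_of_lt_csSup ⟨a, h.left_mem_branchInv hx⟩ hyx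
  have haz : a < z := hy.trans hyz
  rw [Function.update_of_ne haz.ne'] at hzx
  exact ⟨hyz.trans hz.2, (h.strictMonoOn ⟨hy, hyz.trans hz.2⟩ ⟨haz, hz.2⟩ hyz).le.trans hzx⟩

theorem branchInv_sub_le {x : ℝ} (hx : 0 ≤ x) : branchInv f a b x - a ≤ x / s := by
  rw [sub_le_iff_le_add]
  refine csSup_le ⟨a, h.left_mem_branchInv hx⟩ fun y ⟨hy, hyx⟩ => ?_
  rw [← sub_le_iff_le_add, le_div_iff₀ h.slope_pos]
  rcases hy.1.eq_or_lt with rfl | hay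
  · simpa using hx
  · rw [Function.update_of_ne hay.ne'] at hyx
    linarith [h.slope_mul_le ⟨hay, hy.2⟩]

/-- A convex combination of points of the sublevel sets at `x` and `y` lies in the sublevel set at
the combined height. Near-maximal points suffice, so the supremum need not be attained and the
branch need not be onto. -/
theorem concaveOn_branchInv : ConcaveOn ℝ (Ici 0) (branchInv f a b) := by
  refine ⟨convex_Ici 0, fun x hx y hy t r ht hr htr => ?_⟩
  rcases ht.eq_or_lt with rfl | ht
  · obtain rfl : r = 1 := by linarith
    simp
  rcases hr.eq_or_lt with rfl | hr
  · obtain rfl : t = 1 := by linarith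
    simp
  refine le_of_forall_lt fun c hc => ?_
  set d := t • branchInv f a b x + r • branchInv f a b y - c with hd
  have hdpos : 0 < d := sub_pos.2 hc
  obtain ⟨u, ⟨hu, hux⟩, hux'⟩ := exists_lt_of_lt_csSup ⟨a, h.left_mem_branchInv hx⟩
    (sub_lt_self (branchInv f a b x) hdpos)
  obtain ⟨v, ⟨hv, hvy⟩, hvy'⟩ := exists_lt_of_lt_csSup ⟨a, h.left_mem_branchInv hy⟩
    (sub_lt_self (branchInv f a b y) hdpos)
  have hmem : t • u + r • v ≤ branchInv f a b (t • x + r • y) := by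
    refine le_csSup (bddAbove_branchInv f a b _)
      ⟨convex_Ico a b hu hv ht.le hr.le htr, ?_⟩
    refine (h.convexOn_update.2 hu hv ht.le hr.le htr).trans ?_
    gcongr
  refine lt_of_lt_of_le ?_ hmem
  simp only [smul_eq_mul] at *
  have h1 := mul_lt_mul_of_pos_left hux' ht
  have h2 := mul_lt_mul_of_pos_left hvy' hr
  have h3 : t * d + r * d = d := by rw [← add_mul, htr, one_mul]
  linarith

end IsConvexBranch

/-! ### The transfer operator and its slope inequality. -/

/-- The image under `τ` of the part of `ν` which lives on `(a, b)`. -/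
noncomputable def branchMap (τ : unitInterval → unitInterval) (a b : ℝ)
    (ν : Measure unitInterval) : Measure unitInterval :=
  (ν.restrict {y | (y : ℝ) ∈ Ioo a b}).map τ

theorem measurableSet_coe_Ioo (a b : ℝ) : MeasurableSet {y : unitInterval | (y : ℝ) ∈ Ioo a b} :=
  measurable_subtype_coe measurableSet_Ioo

instance (τ : unitInterval → unitInterval) (a b : ℝ) (ν : Measure unitInterval)
    [IsFiniteMeasure ν] : IsFiniteMeasure (branchMap τ a b ν) := by
  unfold branchMap; infer_instance

theorem realMap_coe (τ : unitInterval → unitInterval) (y : unitInterval) :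
    realMap τ y = τ y := IccExtend_val _ _ y

/-- The points of the branch with image at most `x` fill `(a, p]`, with `p` the generalized inverse
at `x`, except possibly for `p` itself, which carries no mass. -/
theorem distFun_branchMap {τ : unitInterval → unitInterval} (hτ : Measurable τ) {a b s L : ℝ}
    (h : IsConvexBranch (realMap τ) a b s) {ν : Measure unitInterval} [IsFiniteMeasure ν]
    (hν : HasConcaveDistFun ν L) {x : ℝ} (hx : 0 ≤ x) :
    distFun (branchMap τ a b ν) x
      = distFun ν (branchInv (realMap τ) a b x) - distFun ν a := by
  rw [distFun_sub ν (h.left_le_branchInv hx), distFun, branchMap,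
    map_measureReal_apply hτ (measurableSet_coe_le x),
    measureReal_restrict_apply (hτ (measurableSet_coe_le x))]
  set p := branchInv (realMap τ) a b x
  refine le_antisymm (measureReal_mono ?_) ?_
  · rintro y ⟨hy, hab⟩
    exact ⟨hab.1, IsConvexBranch.le_branchInv hab (by rw [realMap_coe]; exact hy)⟩
  · have hsub : {y : unitInterval | a < (y : ℝ) ∧ (y : ℝ) ≤ p} ⊆
        (τ ⁻¹' {y | (y : ℝ) ≤ x} ∩ {y | (y : ℝ) ∈ Ioo a b}) ∪ {y | (y : ℝ) = p} := by
      rintro y ⟨hy, hyp⟩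
      rcases hyp.eq_or_lt with e | hlt
      · exact Or.inr e
      · have := h.apply_le_of_lt_branchInv hx hy hlt
        rw [realMap_coe] at this
        exact Or.inl ⟨this.2, hy, this.1⟩
    refine (measureReal_mono hsub).trans ((measureReal_union_le _ _).trans_eq ?_)
    rw [hν.real_singleton p, add_zero]

/-- A non-decreasing concave function of a concave function is concave. The bound `M` on increments
beyond `a` is kept separate from `L`, so that mass `/ a` can replace `L` when `a > 0`. -/
theorem HasConcaveDistFun.branchMap {τ : unitInterval → unitInterval} (hτ : Measurable τ)
    {a b s L M : ℝ} (ha : 0 ≤ a) (h : IsConvexBranch (realMap τ) a b s)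
    {ν : Measure unitInterval} [IsFiniteMeasure ν] (hν : HasConcaveDistFun ν L) (hM : 0 ≤ M)
    (hinc : ∀ v, a ≤ v → distFun ν v - distFun ν a ≤ M * (v - a)) :
    HasConcaveDistFun (branchMap τ a b ν) (M / s) := by
  constructor
  · have hcomp : ConcaveOn ℝ (Ici 0) (distFun ν ∘ branchInv (realMap τ) a b) := by
      have himage : branchInv (realMap τ) a b '' Ici 0 ⊆ Ici 0 := by
        rintro _ ⟨x, hx, rfl⟩
        exact ha.trans (h.left_le_branchInv hx)
      refine ⟨convex_Ici 0, fun x hx y hy t r ht hr htr => ?_⟩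
      exact (hν.concaveOn.2 (himage ⟨x, hx, rfl⟩) (himage ⟨y, hy, rfl⟩) ht hr htr).trans
        (distFun_mono ν (h.concaveOn_branchInv.2 hx hy ht hr htr))
    have := hcomp.add_const (-distFun ν a)
    refine this.congr fun x hx => ?_
    rw [distFun_branchMap hτ h hν hx, sub_eq_add_neg]
    rfl
  · intro x hx
    rw [distFun_branchMap hτ h hν hx]
    refine (hinc _ (h.left_le_branchInv hx)).trans ?_
    rw [div_mul_eq_mul_div, ← mul_div_assoc']
    exact mul_le_mul_of_nonneg_left (h.branchInv_sub_le hx) hM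

theorem hasSum_distFun {ν : Measure unitInterval} [IsFiniteMeasure ν]
    {ν' : ℕ → Measure unitInterval} (hsum : ν = Measure.sum ν') (x : ℝ) :
    HasSum (fun i => distFun (ν' i) x) (distFun ν x) := by
  have hx : ν {y | (y : ℝ) ≤ x} = ∑' i, ν' i {y | (y : ℝ) ≤ x} := by
    rw [hsum, Measure.sum_apply _ (measurableSet_coe_le x)]
  have hne : ∑' i, ν' i {y | (y : ℝ) ≤ x} ≠ ⊤ := hx ▸ measure_ne_top ν _
  have := ENNReal.hasSum_toReal hne
  rwa [← ENNReal.tsum_toReal_eq (ENNReal.ne_top_of_tsum_ne_top hne), ← hx] at this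

theorem HasConcaveDistFun.sum {ν : Measure unitInterval} [IsFiniteMeasure ν]
    {ν' : ℕ → Measure unitInterval} (hsum : ν = Measure.sum ν') {M : ℕ → ℝ}
    (hν' : ∀ i, HasConcaveDistFun (ν' i) (M i)) {L : ℝ} (hM : HasSum M L) :
    HasConcaveDistFun ν L := by
  refine ⟨⟨convex_Ici 0, fun x hx y hy t r ht hr htr => ?_⟩, fun x hx => ?_⟩
  · exact hasSum_le (fun i => (hν' i).concaveOn.2 hx hy ht hr htr)
      (((hasSum_distFun hsum x).const_smul t).add ((hasSum_distFun hsum y).const_smul r))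
      (hasSum_distFun hsum _)
  · exact hasSum_le (fun i => (hν' i).le_mul x hx) (hasSum_distFun hsum x) (hM.mul_right x)

namespace IsPiecewiseConvexMap

variable {τ : unitInterval → unitInterval} {a b s : ℕ → ℝ} (hτ : IsPiecewiseConvexMap τ a b s)

include hτ

theorem isConvexBranch (i : ℕ) : IsConvexBranch (realMap τ) (a i) (b i) (s i) :=
  ⟨hτ.left_lt_right i, hτ.strictMonoOn i, hτ.convexOn i, hτ.differentiableOn i,
    hτ.tendsto_left i, hτ.tendsto_deriv i, hτ.slope_pos i⟩

theorem ae_mem : ∀ᵐ y : unitInterval, ∃ i, (y : ℝ) ∈ Ioo (a i) (b i) := by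
  rw [ae_iff, unitInterval.volume_apply]
  refine measure_mono_null ?_ hτ.null_compl
  rintro _ ⟨y, hy, rfl⟩
  exact ⟨y.2, by simpa using hy⟩

theorem eq_of_mem {i j : ℕ} {x : ℝ} (hi : x ∈ Ioo (a i) (b i)) (hj : x ∈ Ioo (a j) (b j)) :
    i = j := by
  by_contra hij
  exact Set.disjoint_left.1 (hτ.disjoint hij) hi hj

theorem map_eq_sum {ν : Measure unitInterval} (hν : ν ≪ volume) :
    ν.map τ = Measure.sum fun i => branchMap τ (a i) (b i) ν := by
  have h1 : ν = ν.restrict (⋃ i, {y | (y : ℝ) ∈ Ioo (a i) (b i)}) := by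
    refine (Measure.restrict_eq_self_of_ae_mem ?_).symm
    filter_upwards [hν.ae_le hτ.ae_mem] with y hy
    simpa using hy
  have hd : Pairwise (Function.onFun Disjoint
      fun i => {y : unitInterval | (y : ℝ) ∈ Ioo (a i) (b i)}) := fun i j hij =>
    Set.disjoint_left.2 fun y hi hj => hij (hτ.eq_of_mem hi hj)
  rw [Measure.restrict_iUnion hd fun i => measurableSet_coe_Ioo _ _] at h1
  conv_lhs => rw [h1]
  rw [Measure.map_sum hτ.measurable.aemeasurable]
  rfl

theorem eq_of_left_eq_zero {i j : ℕ} (hi : a i = 0) (hj : a j = 0) : i = j := by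
  obtain ⟨x, hx0, hx⟩ := exists_between (lt_min (hτ.left_lt_right i) (hi ▸ hj ▸ hτ.left_lt_right j))
  exact hτ.eq_of_mem ⟨hx0, hx.trans_le (min_le_left _ _)⟩
    ⟨by rwa [hj, ← hi], hx.trans_le (min_le_right _ _)⟩

/-- If a branch starts at `0`, disjointness keeps every other branch to the right of `b i`; so `0`
is not a limit point of the partition and the expansion hypothesis applies. -/
theorem one_lt_slope {i : ℕ} (hi : a i = 0) : 1 < s i := by
  refine hτ.one_lt_slope_zero ?_ i hi
  have hb : 0 < b i := hi ▸ hτ.left_lt_right i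
  intro hacc
  rw [accPt_iff_nhds] at hacc
  obtain ⟨p, ⟨hpb, hp⟩, hp0⟩ := hacc (Iio (b i)) (Iio_mem_nhds hb)
  have key : ∀ j, a j < b i → j = i := fun j hj => by
    obtain ⟨x, hx0, hx⟩ := exists_between (lt_min (hτ.left_lt_right j) hj)
    exact hτ.eq_of_mem ⟨hx0, hx.trans_le (min_le_left _ _)⟩
      ⟨by rw [hi]; exact (hτ.nonneg_left j).trans_lt hx0, hx.trans_le (min_le_right _ _)⟩
  rcases hp with ⟨j, rfl⟩ | ⟨j, rfl⟩
  · exact hp0 (key j hpb ▸ hi)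
  · obtain rfl := key j ((hτ.left_lt_right j).trans hpb)
    exact lt_irrefl (b j) hpb

theorem tsum_ite_left_eq_zero_lt_one : ∑' i, (if a i = 0 then 1 / s i else 0) < 1 := by
  by_cases h : ∃ i, a i = 0
  · obtain ⟨i, hi⟩ := h
    rw [tsum_eq_single i fun j hj => if_neg fun h0 => hj (hτ.eq_of_left_eq_zero h0 hi), if_pos hi,
      div_lt_one (hτ.slope_pos i)]
    exact hτ.one_lt_slope hi
  · push Not at h
    simp [h]

/-- The transfer operator contracts the slope at `0` of the distribution function, up to a multiple
of the mass. -/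
theorem exists_hasConcaveDistFun_map : ∃ α K : ℝ, 0 ≤ α ∧ α < 1 ∧ 0 ≤ K ∧
    ∀ (ν : Measure unitInterval) [IsFiniteMeasure ν] (L : ℝ), HasConcaveDistFun ν L →
      HasConcaveDistFun (ν.map τ) (α * L + K * ν.real univ) := by
  have hs : ∀ i, 0 ≤ 1 / s i := fun i => (one_div_pos.2 (hτ.slope_pos i)).le
  set β := ∑' i, (if a i = 0 then 1 / s i else 0)
  have hβ : HasSum (fun i => if a i = 0 then 1 / s i else 0) β := by
    refine (Summable.of_nonneg_of_le (fun i => ?_) (fun i => ?_) hτ.summable_inv_slope).hasSum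
    · split_ifs <;> simp [(hτ.slope_pos i).le]
    · split_ifs <;> simp [(hτ.slope_pos i).le]
  have hS := hτ.summable_inv_slope.hasSum
  set S := ∑' i, 1 / s i
  -- The finite set `t` leaves a tail of `∑ 1 / s i` below `1 - β`, which makes `α = β +` tail less
  -- than `1`. The branches in `t` with `a i > 0` are charged to the mass, through `K`.
  obtain ⟨t, ht⟩ := (hS.eventually (lt_mem_nhds (a := S - (1 - β))
    (by linarith [hτ.tsum_ite_left_eq_zero_lt_one]))).exists
  have htail : HasSum (fun i => if i ∈ t then 0 else 1 / s i) (S - ∑ i ∈ t, 1 / s i) := by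
    have := hS.sub (hasSum_sum_of_ne_finset_zero (s := t)
      (f := fun i => if i ∈ t then 1 / s i else 0) fun i hi => if_neg hi)
    rw [Finset.sum_congr rfl fun i hi => if_pos hi] at this
    have e : (fun i => if i ∈ t then 0 else 1 / s i)
        = fun i => 1 / s i - if i ∈ t then 1 / s i else 0 := by
      funext i
      split_ifs <;> simp
    rw [e]
    exact this
  set K := ∑ i ∈ t, if a i = 0 ∨ i ∉ t then 0 else 1 / a i / s i
  have hK : HasSum (fun i => if a i = 0 ∨ i ∉ t then 0 else 1 / a i / s i) K :=
    hasSum_sum_of_ne_finset_zero fun i hi => if_pos (Or.inr hi)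
  refine ⟨β + (S - ∑ i ∈ t, 1 / s i), K, ?_, by linarith, ?_, fun ν _ L hν => ?_⟩
  · refine (hβ.add htail).nonneg fun i => add_nonneg ?_ ?_
    · split_ifs <;> simp [(hτ.slope_pos i).le]
    · split_ifs <;> simp [(hτ.slope_pos i).le]
  · refine hK.nonneg fun i => ?_
    split_ifs
    · exact le_rfl
    · exact div_nonneg (one_div_nonneg.2 (hτ.nonneg_left i)) (hτ.slope_pos i).le
  refine HasConcaveDistFun.sum (hτ.map_eq_sum hν.absolutelyContinuous) (fun i => ?_)
    (((hβ.add htail).mul_right L).add (hK.mul_right (ν.real univ)))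
  have hL := hν.nonneg
  have hM : 0 ≤ ν.real univ := measureReal_nonneg
  have hsi := hs i
  by_cases h : a i = 0 ∨ i ∉ t
  · have := HasConcaveDistFun.branchMap hτ.measurable (hτ.nonneg_left i) (hτ.isConvexBranch i) hν hL
      fun v hv => hν.sub_le_mul hv
    refine this.mono_right ?_
    rw [if_pos h, zero_mul, add_zero, div_eq_mul_one_div, mul_comm]
    refine mul_le_mul_of_nonneg_right ?_ hL
    rcases h with h | h
    · rw [if_pos h]
      exact le_add_of_nonneg_right (by split_ifs <;> simp [(hτ.slope_pos i).le])
    · rw [if_neg h]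
      exact le_add_of_nonneg_left (by split_ifs <;> simp [(hτ.slope_pos i).le])
  · have ha : 0 < a i := (hτ.nonneg_left i).lt_of_ne' fun h0 => h (Or.inl h0)
    have := HasConcaveDistFun.branchMap hτ.measurable (hτ.nonneg_left i) (hτ.isConvexBranch i) hν
      (div_nonneg hM ha.le) fun v hv => hν.sub_le_div_mul_real_univ ha hv
    refine this.mono_right ?_
    rw [if_neg h]
    have h2 : 0 ≤ ((if a i = 0 then 1 / s i else 0) + if i ∈ t then 0 else 1 / s i) * L := by
      refine mul_nonneg (add_nonneg ?_ ?_) hL <;> split_ifs <;> simp [(hτ.slope_pos i).le]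
    refine le_add_of_nonneg_of_le h2 (le_of_eq ?_)
    ring

/-- Iterates of the transfer operator bring the slope of the distribution function below a fixed
multiple of the mass. -/
theorem exists_hasConcaveDistFun_iterate : ∃ C : ℝ, 1 ≤ C ∧
    (∀ (ν : Measure unitInterval) [IsFiniteMeasure ν] (L : ℝ), HasConcaveDistFun ν L →
      ∀ n, HasConcaveDistFun (ν.map τ^[n]) (L + C * ν.real univ)) ∧
    ∀ (ν : Measure unitInterval) [IsFiniteMeasure ν] (L : ℝ), HasConcaveDistFun ν L →
      0 < ν.real univ → ∀ᶠ n in atTop, HasConcaveDistFun (ν.map τ^[n]) (C * ν.real univ) := by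
  obtain ⟨α, K, hα0, hα1, hK, H⟩ := hτ.exists_hasConcaveDistFun_map
  have hα : 0 < 1 - α := sub_pos.2 hα1
  have hKα : 0 ≤ K / (1 - α) := div_nonneg hK hα.le
  have key : ∀ (ν : Measure unitInterval) [IsFiniteMeasure ν] (L : ℝ), HasConcaveDistFun ν L →
      ∀ n, HasConcaveDistFun (ν.map τ^[n]) (α ^ n * L + K / (1 - α) * ν.real univ) := by
    intro ν _ L hν n
    induction n with
    | zero =>
      simp only [Function.iterate_zero, Measure.map_id, pow_zero, one_mul]
      exact hν.mono_right (le_add_of_nonneg_right (mul_nonneg hKα measureReal_nonneg))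
    | succ n ih =>
      have h1 := H _ _ ih
      rw [Measure.map_map hτ.measurable (hτ.measurable.iterate n), ← Function.iterate_succ',
        map_measureReal_apply (hτ.measurable.iterate n) MeasurableSet.univ, preimage_univ] at h1
      refine h1.mono_right (le_of_eq ?_)
      field_simp
      ring
  -- The extra `1` absorbs the transient `α ^ n * L` once it is below the mass.
  refine ⟨K / (1 - α) + 1, by linarith, fun ν _ L hν n => ?_, fun ν _ L hν hM => ?_⟩
  · refine (key ν L hν n).mono_right ?_
    have h1 := mul_le_of_le_one_left hν.nonneg (pow_le_one₀ (n := n) hα0 hα1.le)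
    nlinarith [measureReal_nonneg (μ := ν) (s := univ)]
  · have hlim : Tendsto (fun n : ℕ => α ^ n * L) atTop (𝓝 (0 * L)) :=
      (tendsto_pow_atTop_nhds_zero_of_lt_one hα0 hα1).mul_const L
    rw [zero_mul] at hlim
    filter_upwards [hlim.eventually (gt_mem_nhds hM)] with n hn
    refine (key ν L hν n).mono_right ?_
    linarith

end IsPiecewiseConvexMap

/-! ### Itineraries separate points. -/

namespace IsPiecewiseConvexMap

variable {τ : unitInterval → unitInterval} {a b s : ℕ → ℝ} (hτ : IsPiecewiseConvexMap τ a b s)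

include hτ

theorem iterate_mem_Icc {x y : unitInterval} {i : ℕ → ℕ} {n : ℕ}
    (hx : ∀ k < n, (τ^[k] x : ℝ) ∈ Ioo (a (i k)) (b (i k)))
    (hy : ∀ k < n, (τ^[k] y : ℝ) ∈ Ioo (a (i k)) (b (i k))) {z : unitInterval} (hz : z ∈ Icc x y) :
    τ^[n] z ∈ Icc (τ^[n] x) (τ^[n] y) := by
  induction n with
  | zero => exact hz
  | succ n ih =>
    have hm : ∀ {u v : unitInterval}, (u : ℝ) ∈ Ioo (a (i n)) (b (i n)) →
        (v : ℝ) ∈ Ioo (a (i n)) (b (i n)) → u ≤ v → τ u ≤ τ v := by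
      intro u v hu hv huv
      have := (hτ.strictMonoOn (i n)).monotoneOn hu hv huv
      rwa [realMap_coe, realMap_coe] at this
    have ih' := ih (fun k hk => hx k (hk.trans n.lt_succ_self))
      (fun k hk => hy k (hk.trans n.lt_succ_self))
    have hxn := hx n n.lt_succ_self
    have hyn := hy n n.lt_succ_self
    have hzn : (τ^[n] z : ℝ) ∈ Ioo (a (i n)) (b (i n)) :=
      ⟨hxn.1.trans_le ih'.1, lt_of_le_of_lt ih'.2 hyn.2⟩
    simp only [Function.iterate_succ_apply']
    exact ⟨hm hxn hzn ih'.1, hm hzn hyn ih'.2⟩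

/-- The iterate `τ^[n]` maps `[x, y]` into the interval between the image points, and the image of
Lebesgue measure has density at most `1 + C`; so that interval has length at least `(y - x) / (1 +
C)`. -/
theorem exists_le_iterate_sub {x y : unitInterval} (hxy : x < y) {i : ℕ → ℕ}
    (hx : ∀ n, (τ^[n] x : ℝ) ∈ Ioo (a (i n)) (b (i n)))
    (hy : ∀ n, (τ^[n] y : ℝ) ∈ Ioo (a (i n)) (b (i n))) :
    ∃ d : ℝ, 0 < d ∧ ∀ n, d ≤ τ^[n] y - τ^[n] x := by
  obtain ⟨C, hC, H, -⟩ := hτ.exists_hasConcaveDistFun_iterate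
  have hC' : 0 < 1 + C := by linarith
  have hvol : ∀ u v : unitInterval, u ≤ v → volume.real (Icc u v) = (v : ℝ) - u := by
    intro u v huv
    rw [measureReal_def, unitInterval.volume_Icc, ENNReal.toReal_ofReal (sub_nonneg.2 huv)]
  refine ⟨((y : ℝ) - x) / (1 + C), div_pos (sub_pos.2 hxy) hC', fun n => ?_⟩
  have h1 := (H volume 1 hasConcaveDistFun_volume n).real_le (Icc (τ^[n] x) (τ^[n] y))
  rw [map_measureReal_apply (hτ.measurable.iterate n) measurableSet_Icc, hvol _ _
    (hτ.iterate_mem_Icc (fun k _ => hx k) (fun k _ => hy k) (left_mem_Icc.2 hxy.le)).2] at h1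
  have h2 : volume.real (Icc x y) ≤ volume.real (τ^[n] ⁻¹' Icc (τ^[n] x) (τ^[n] y)) :=
    measureReal_mono fun z hz => hτ.iterate_mem_Icc (fun k _ => hx k) (fun k _ => hy k) hz
  rw [hvol _ _ hxy.le] at h2
  rw [div_le_iff₀ hC']
  simp only [probReal_univ, mul_one] at h1
  linarith

theorem le_one_div_slope {u v : unitInterval} {i : ℕ} (hu : (u : ℝ) ∈ Ioo (a i) (b i))
    (hv : (v : ℝ) ∈ Ioo (a i) (b i)) : (v : ℝ) - u ≤ 1 / s i := by
  have h1 := (hτ.isConvexBranch i).slope_mul_le hv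
  rw [realMap_coe] at h1
  rw [le_div_iff₀ (hτ.slope_pos i)]
  nlinarith [(τ v).2.2, hτ.slope_pos i, hu.1]

/-- Secants from `a i` steepen, so the image ratio is at least `(v - a i) / (u - a i)`. This exceeds
`v / u` by `a i * (v - u) / (u * (u - a i))`, whose denominator is at most `1`. -/
theorem div_add_le_div {u v : unitInterval} {i : ℕ} (hu : (u : ℝ) ∈ Ioo (a i) (b i))
    (hv : (v : ℝ) ∈ Ioo (a i) (b i)) (huv : u ≤ v) :
    (v : ℝ) / u + a i * (v - u) ≤ τ v / τ u := by
  have ha := hτ.nonneg_left i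
  have hu0 : (0 : ℝ) < u := ha.trans_lt hu.1
  have hua : 0 < (u : ℝ) - a i := sub_pos.2 hu.1
  have huv' : (u : ℝ) ≤ v := huv
  have hτu : (0 : ℝ) < τ u := by
    have := (hτ.isConvexBranch i).pos hu
    rwa [realMap_coe] at this
  have h1 := (hτ.isConvexBranch i).secant_mul_le hu.1 huv' hv.2
  rw [realMap_coe, realMap_coe] at h1
  have h2 : ((v : ℝ) - a i) / (u - a i) ≤ τ v / τ u := by
    rw [div_le_div_iff₀ hua hτu]
    linarith
  refine le_trans ?_ h2
  have h3 : ((v : ℝ) - a i) / (u - a i) = v / u + a i * (v - u) / (u * (u - a i)) := by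
    field_simp
    ring
  rw [h3]
  refine add_le_add_right ?_ _
  have h4 : (u : ℝ) * (u - a i) ≤ 1 := by nlinarith [u.2.2]
  rw [le_div_iff₀ (mul_pos hu0 hua)]
  exact mul_le_of_le_one_right (mul_nonneg ha (sub_nonneg.2 huv')) h4

/-- Distinct points do not visit the same branches forever. -/
theorem not_forall_iterate_mem {x y : unitInterval} (hxy : x < y) (i : ℕ → ℕ)
    (hx : ∀ n, (τ^[n] x : ℝ) ∈ Ioo (a (i n)) (b (i n)))
    (hy : ∀ n, (τ^[n] y : ℝ) ∈ Ioo (a (i n)) (b (i n))) : False := by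
  obtain ⟨d, hd, hdn⟩ := hτ.exists_le_iterate_sub hxy hx hy
  have hle : ∀ n, τ^[n] x ≤ τ^[n] y := fun n => by
    have := hdn n
    exact Subtype.coe_le_coe.1 (by linarith)
  -- A branch containing two points at distance `d` has `1 / s j ≥ d`, so the common itinerary uses
  -- finitely many branches, and their nonzero left ends are bounded below by some `η`.
  have hfin : {j | ¬ 1 / s j < d}.Finite :=
    hτ.summable_inv_slope.tendsto_cofinite_zero.eventually (gt_mem_nhds hd)
  obtain ⟨η, hη, hη0⟩ : ∃ η, (∀ j ∈ {j | ¬ 1 / s j < d}, a j = 0 ∨ η ≤ a j) ∧ 0 < η := by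
    have h1 : ∀ᶠ η in 𝓝[>] (0 : ℝ), ∀ j ∈ {j | ¬ 1 / s j < d}, a j = 0 ∨ η ≤ a j := by
      refine (eventually_all_finite hfin).2 fun j _ => ?_
      rcases (hτ.nonneg_left j).eq_or_lt with h0 | h0
      · exact Eventually.of_forall fun _ => Or.inl h0.symm
      · filter_upwards [Ioo_mem_nhdsGT h0] with η hη using Or.inr hη.2.le
    exact (h1.and self_mem_nhdsWithin).exists
  have ha : ∀ n, a (i n) = 0 ∨ η ≤ a (i n) := fun n =>
    hη _ (not_lt.2 ((hdn n).trans (hτ.le_one_div_slope (hx n) (hy n))))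
  -- If the orbits eventually stay in the branch at `0`, its expansion drives them out of `[0, 1]`.
  -- Otherwise the ratio of the orbits never decreases and gains `η * d` at each visit to a branch
  -- with `a j ≥ η`; yet at those visits it is at most `1 / η`.
  by_cases hev : ∃ N, ∀ n, N ≤ n → a (i n) = 0
  · obtain ⟨N, hN⟩ := hev
    have hi : ∀ n, N ≤ n → i n = i N := fun n hn => hτ.eq_of_left_eq_zero (hN n hn) (hN N le_rfl)
    have h0 := hN N le_rfl
    have hpos : (0 : ℝ) < τ^[N] x := h0 ▸ (hx N).1
    obtain ⟨k, hk⟩ := pow_unbounded_of_one_lt (1 / (τ^[N] x : ℝ)) (hτ.one_lt_slope h0)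
    have hgrow : ∀ k, s (i N) ^ k * τ^[N] x ≤ τ^[N + k] x := by
      intro k
      induction k with
      | zero => simp
      | succ k ih =>
        have h1 := (hτ.isConvexBranch (i N)).slope_mul_le (hi (N + k) (by omega) ▸ hx (N + k))
        rw [realMap_coe, h0, sub_zero, ← Function.iterate_succ_apply' τ] at h1
        rw [pow_succ', mul_assoc]
        exact (mul_le_mul_of_nonneg_left ih (hτ.slope_pos _).le).trans h1
    rw [div_lt_iff₀ hpos] at hk
    linarith [hgrow k, (τ^[N + k] x).2.2]
  · push Not at hev
    have hmono : Monotone fun n => (τ^[n] y : ℝ) / τ^[n] x := by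
      refine monotone_nat_of_le_succ fun n => ?_
      have h1 := hτ.div_add_le_div (hx n) (hy n) (hle n)
      rw [← Function.iterate_succ_apply' τ, ← Function.iterate_succ_apply' τ] at h1
      have := mul_nonneg (hτ.nonneg_left (i n)) (hd.le.trans (hdn n))
      linarith
    have hunb : ∀ k : ℕ, ∃ n, k * (η * d) ≤ (τ^[n] y : ℝ) / τ^[n] x := by
      intro k
      induction k with
      | zero => exact ⟨0, by simpa using div_nonneg (τ^[0] y).2.1 (τ^[0] x).2.1⟩
      | succ k ih =>
        obtain ⟨n, hn⟩ := ih
        obtain ⟨m, hnm, hm⟩ := hev n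
        refine ⟨m + 1, ?_⟩
        have h1 := hτ.div_add_le_div (hx m) (hy m) (hle m)
        rw [← Function.iterate_succ_apply' τ, ← Function.iterate_succ_apply' τ] at h1
        have h2 := mul_le_mul ((ha m).resolve_left hm) (hdn m) hd.le (hτ.nonneg_left (i m))
        have h3 : (τ^[n] y : ℝ) / τ^[n] x ≤ τ^[m] y / τ^[m] x := hmono hnm
        push_cast
        linarith
    obtain ⟨k, hk⟩ := exists_nat_gt (1 / η / (η * d))
    obtain ⟨n, hn⟩ := hunb k
    obtain ⟨m, hnm, hm⟩ := hev n
    have h3 : (τ^[n] y : ℝ) / τ^[n] x ≤ τ^[m] y / τ^[m] x := hmono hnm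
    have h4 : (τ^[m] y : ℝ) / τ^[m] x ≤ 1 / η :=
      div_le_div₀ zero_le_one (τ^[m] y).2.2 hη0 (((ha m).resolve_left hm).trans (hx m).1.le)
    rw [div_lt_iff₀ (by positivity)] at hk
    linarith

end IsPiecewiseConvexMap

/-! ### Cylinders and triviality of the tail. -/

/-- The points of `[0, 1]` which visit the intervals `(a (w k), b (w k))`, `k < n`, in turn. -/
def branchCylinder (τ : unitInterval → unitInterval) (a b : ℕ → ℝ) {n : ℕ} (w : Fin n → ℕ) :
    Set unitInterval :=
  {y | ∀ k : Fin n, (τ^[k] y : ℝ) ∈ Ioo (a (w k)) (b (w k))}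

theorem branchCylinder_subset (τ : unitInterval → unitInterval) (a b : ℕ → ℝ) (i : ℕ → ℕ) {m n : ℕ} (hmn : m ≤ n) :
    branchCylinder τ a b (fun k : Fin n => i k) ⊆ branchCylinder τ a b (fun k : Fin m => i k) :=
  fun _ hz k => hz ⟨k, k.2.trans_le hmn⟩

namespace IsPiecewiseConvexMap

variable {τ : unitInterval → unitInterval} {a b s : ℕ → ℝ} (hτ : IsPiecewiseConvexMap τ a b s)

include hτ

theorem measurableSet_cylinder {n : ℕ} (w : Fin n → ℕ) : MeasurableSet (branchCylinder τ a b w) := by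
  have : branchCylinder τ a b w = ⋂ k : Fin n, τ^[k] ⁻¹' {y | (y : ℝ) ∈ Ioo (a (w k)) (b (w k))} := by
    ext y
    simp [branchCylinder]
  rw [this]
  exact MeasurableSet.iInter fun k => hτ.measurable.iterate k (measurableSet_coe_Ioo _ _)

theorem eq_of_mem_cylinder {n : ℕ} {w w' : Fin n → ℕ} {y : unitInterval}
    (h : y ∈ branchCylinder τ a b w) (h' : y ∈ branchCylinder τ a b w') : w = w' :=
  funext fun k => hτ.eq_of_mem (h k) (h' k)

theorem ordConnected_cylinder (i : ℕ → ℕ) (n : ℕ) :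
    OrdConnected (branchCylinder τ a b fun k : Fin n => i k) := by
  refine ⟨fun x hx y hy z hz k => ?_⟩
  have hz' := hτ.iterate_mem_Icc (i := i) (n := k) (fun j hj => hx ⟨j, hj.trans k.2⟩)
    (fun j hj => hy ⟨j, hj.trans k.2⟩) hz
  exact ⟨(hx k).1.trans_le hz'.1, lt_of_le_of_lt hz'.2 (hy k).2⟩

/-- Peeling off the first letter of `w` exhibits the measure as a succession of branch images. The
size of `L'` is irrelevant, since further iteration forgets it. -/
theorem exists_hasConcaveDistFun_cylinder {n : ℕ} (w : Fin n → ℕ) (ν : Measure unitInterval)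
    [IsFiniteMeasure ν] {L : ℝ} (hν : HasConcaveDistFun ν L) :
    ∃ L', HasConcaveDistFun ((ν.restrict (branchCylinder τ a b w)).map τ^[n]) L' := by
  induction n generalizing ν L with
  | zero =>
    have : branchCylinder τ a b w = univ := eq_univ_of_forall fun y k => k.elim0
    exact ⟨L, by simpa [this] using hν⟩
  | succ n ih =>
    obtain ⟨L', hL'⟩ := ih (Fin.tail w) _ (HasConcaveDistFun.branchMap hτ.measurable
      (hτ.nonneg_left (w 0)) (hτ.isConvexBranch (w 0)) hν hν.nonneg fun v hv => hν.sub_le_mul hv)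
    refine ⟨L', ?_⟩
    have hcyl : branchCylinder τ a b w = τ ⁻¹' branchCylinder τ a b (Fin.tail w) ∩
        {y | (y : ℝ) ∈ Ioo (a (w 0)) (b (w 0))} := by
      ext y
      simp only [branchCylinder, mem_ofPred_eq, Fin.forall_fin_succ, mem_inter_iff, mem_preimage]
      exact and_comm
    rw [branchMap, Measure.restrict_map hτ.measurable (hτ.measurableSet_cylinder _),
      Measure.restrict_restrict (hτ.measurable (hτ.measurableSet_cylinder _)), ← hcyl,
      Measure.map_map (hτ.measurable.iterate n) hτ.measurable, ← Function.iterate_succ] at hL'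
    exact hL'

/-- Otherwise every cylinder around `y` reaches `p` or beyond and, being order connected, contains
`p`; then `p` shares the itinerary of `y`. -/
theorem exists_cylinder_lt {y : unitInterval} {i : ℕ → ℕ}
    (hy : ∀ n, (τ^[n] y : ℝ) ∈ Ioo (a (i n)) (b (i n))) {p : unitInterval} (hp : y < p) :
    ∃ N, ∀ z ∈ branchCylinder τ a b (fun k : Fin N => i k), z < p := by
  by_contra! hcon
  refine hτ.not_forall_iterate_mem hp i hy fun n => ?_
  obtain ⟨z, hz, hpz⟩ := hcon (n + 1)
  exact (hτ.ordConnected_cylinder i (n + 1)).out (fun k => hy k) hz ⟨hp.le, hpz⟩ (Fin.last n)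

theorem exists_lt_cylinder {y : unitInterval} {i : ℕ → ℕ}
    (hy : ∀ n, (τ^[n] y : ℝ) ∈ Ioo (a (i n)) (b (i n))) {p : unitInterval} (hp : p < y) :
    ∃ N, ∀ z ∈ branchCylinder τ a b (fun k : Fin N => i k), p < z := by
  by_contra! hcon
  refine hτ.not_forall_iterate_mem hp i (fun n => ?_) hy
  obtain ⟨z, hz, hpz⟩ := hcon (n + 1)
  exact (hτ.ordConnected_cylinder i (n + 1)).out hz (fun k => hy k) ⟨hpz, hp.le⟩ (Fin.last n)

/-- Cylinders shrink to points. -/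
theorem exists_cylinder_subset {y : unitInterval} {i : ℕ → ℕ}
    (hy : ∀ n, (τ^[n] y : ℝ) ∈ Ioo (a (i n)) (b (i n))) {U : Set unitInterval} (hU : IsOpen U)
    (hyU : y ∈ U) : ∃ N, branchCylinder τ a b (fun k : Fin N => i k) ⊆ U := by
  obtain ⟨r, hr, hrU⟩ := Metric.isOpen_iff.1 hU y hyU
  have h1 : ∃ N, ∀ z ∈ branchCylinder τ a b (fun k : Fin N => i k), (z : ℝ) < y + r := by
    rcases le_or_gt ((y : ℝ) + r / 2) 1 with h | h
    · obtain ⟨N, hN⟩ := hτ.exists_cylinder_lt hy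
        (p := ⟨y + r / 2, by linarith [y.2.1], h⟩) (Subtype.coe_lt_coe.1 (by simpa using hr))
      refine ⟨N, fun z hz => ?_⟩
      have : (z : ℝ) < y + r / 2 := hN z hz
      linarith
    · exact ⟨0, fun z _ => by linarith [z.2.2]⟩
  have h2 : ∃ N, ∀ z ∈ branchCylinder τ a b (fun k : Fin N => i k), (y : ℝ) - r < z := by
    rcases le_or_gt 0 ((y : ℝ) - r / 2) with h | h
    · obtain ⟨N, hN⟩ := hτ.exists_lt_cylinder hy
        (p := ⟨y - r / 2, h, by linarith [y.2.2]⟩) (Subtype.coe_lt_coe.1 (by simpa using hr))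
      refine ⟨N, fun z hz => ?_⟩
      have : (y : ℝ) - r / 2 < z := hN z hz
      linarith
    · exact ⟨0, fun z _ => by linarith [z.2.1]⟩
  obtain ⟨N₁, hN₁⟩ := h1
  obtain ⟨N₂, hN₂⟩ := h2
  refine ⟨max N₁ N₂, fun z hz => hrU ?_⟩
  rw [Metric.mem_ball, Subtype.dist_eq, Real.dist_eq, abs_lt]
  have h1 := hN₁ z (branchCylinder_subset τ a b i (le_max_left _ _) hz)
  have h2 := hN₂ z (branchCylinder_subset τ a b i (le_max_right _ _) hz)
  constructor <;> linarith

theorem ae_forall_iterate_mem :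
    ∀ᵐ y : unitInterval, ∃ i : ℕ → ℕ, ∀ n, (τ^[n] y : ℝ) ∈ Ioo (a (i n)) (b (i n)) := by
  obtain ⟨C, -, H, -⟩ := hτ.exists_hasConcaveDistFun_iterate
  have : ∀ᵐ y : unitInterval, ∀ n, ∃ i, (τ^[n] y : ℝ) ∈ Ioo (a i) (b i) :=
    ae_all_iff.2 fun n => ae_of_ae_map (hτ.measurable.iterate n).aemeasurable
      ((H volume 1 hasConcaveDistFun_volume n).absolutelyContinuous.ae_le hτ.ae_mem)
  filter_upwards [this] with y hy
  exact ⟨fun n => (hy n).choose, fun n => (hy n).choose_spec⟩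

/-- Every set of positive measure fills some cylinder up to a given proportion. -/
theorem exists_cylinder_sdiff_le {A : Set unitInterval} (hAm : MeasurableSet A)
    (hA : volume A ≠ 0)
    {δ : ENNReal} (hδ : δ ≠ 0) :
    ∃ (n : ℕ) (w : Fin n → ℕ), volume (branchCylinder τ a b w) ≠ 0 ∧
      volume (branchCylinder τ a b w \ A) ≤ δ * volume (branchCylinder τ a b w) := by
  by_contra! hcon
  have hall : ∀ (n : ℕ) (w : Fin n → ℕ),
      δ * volume (branchCylinder τ a b w) ≤ volume (branchCylinder τ a b w \ A) := fun n w => by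
    by_cases h0 : volume (branchCylinder τ a b w) = 0
    · simp [h0]
    · exact (hcon n w h0).le
  -- If every cylinder had more than the proportion `δ` outside `A`, summing over the disjoint
  -- cylinders of length `n` inside `U` would give `δ * volume (V n) ≤ volume (U \ A)`. These
  -- cylinders exhaust almost all of `A` as `n` grows, against the choice of `U`.
  obtain ⟨U, hAU, hU, -, hUA⟩ := hAm.exists_isOpen_sdiff_lt (measure_ne_top volume A)
    (mul_ne_zero hδ hA)
  let S : (n : ℕ) → Set (Fin n → ℕ) := fun n => {w | branchCylinder τ a b w ⊆ U}
  let V : ℕ → Set unitInterval := fun n => ⋃ w ∈ S n, branchCylinder τ a b w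
  let G : Set unitInterval :=
    {y | ∃ i : ℕ → ℕ, ∀ n, (τ^[n] y : ℝ) ∈ Ioo (a (i n)) (b (i n))}
  have hV : ∀ n, δ * volume (V n) ≤ volume (U \ A) := by
    intro n
    have hd : (S n).PairwiseDisjoint fun w => branchCylinder τ a b w := fun w _ w' _ hne =>
      Set.disjoint_left.2 fun y hy hy' => hne (hτ.eq_of_mem_cylinder hy hy')
    have hd' : (S n).PairwiseDisjoint fun w => branchCylinder τ a b w \ A := fun w hw w' hw' hne =>
      (hd hw hw' hne).mono sdiff_subset sdiff_subset
    calc δ * volume (V n) = ∑' w : S n, δ * volume (branchCylinder τ a b w.1) := by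
          rw [measure_biUnion (S n).to_countable hd fun w _ => hτ.measurableSet_cylinder w,
            ENNReal.tsum_mul_left]
      _ ≤ ∑' w : S n, volume (branchCylinder τ a b w.1 \ A) :=
          ENNReal.tsum_le_tsum fun w => hall n w.1
      _ = volume (⋃ w ∈ S n, branchCylinder τ a b w \ A) :=
          (measure_biUnion (S n).to_countable hd'
            fun w _ => (hτ.measurableSet_cylinder w).diff hAm).symm
      _ ≤ volume (U \ A) :=
          measure_mono (iUnion₂_subset fun w hw => sdiff_subset_sdiff_left hw)
  -- Intersecting with `G` is needed: a point without a full itinerary may lie in no longer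
  -- cylinder.
  have hmono : Monotone fun n => G ∩ V n := by
    rintro m n hmn y ⟨⟨i, hi⟩, hy⟩
    refine ⟨⟨i, hi⟩, ?_⟩
    obtain ⟨w, hw, hyw⟩ := mem_iUnion₂.1 hy
    obtain rfl : w = fun k : Fin m => i k := hτ.eq_of_mem_cylinder hyw fun k => hi k
    exact mem_iUnion₂.2 ⟨fun k : Fin n => i k, (branchCylinder_subset τ a b i hmn).trans hw,
      fun k => hi k⟩
  have hcover : volume A ≤ volume (⋃ n, G ∩ V n) := by
    refine measure_mono_ae ?_
    filter_upwards [hτ.ae_forall_iterate_mem] with y ⟨i, hi⟩ hyA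
    obtain ⟨N, hN⟩ := hτ.exists_cylinder_subset hi hU (hAU hyA)
    exact mem_iUnion.2 ⟨N, ⟨i, hi⟩, mem_iUnion₂.2 ⟨_, hN, fun k => hi k⟩⟩
  refine hUA.not_ge ((mul_le_mul_right hcover δ).trans ?_)
  rw [hmono.measure_iUnion, ENNReal.mul_iSup]
  exact iSup_le fun n => (mul_le_mul_right (measure_mono inter_subset_right) δ).trans (hV n)

/-- Some cylinder `J` has at most the proportion `δ` outside `A`. The image of Lebesgue measure on
`J` eventually has density at least `volume J / 2` near `0`, and it gives `Bᶜ` the mass of `J \ A`.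
Taking `C` as an argument makes the interval near `0` the same for a set and its complement. -/
theorem eventually_volume_compl_le {C : ℝ} (hC : 1 ≤ C)
    (H : ∀ (ν : Measure unitInterval) [IsFiniteMeasure ν] (L : ℝ), HasConcaveDistFun ν L →
      0 < ν.real univ → ∀ᶠ n in atTop, HasConcaveDistFun (ν.map τ^[n]) (C * ν.real univ))
    {A : Set unitInterval} (hAm : MeasurableSet A) (hA : volume A ≠ 0) {δ : ℝ} (hδ : 0 < δ) :
    ∀ᶠ n in atTop, ∀ B : Set unitInterval, MeasurableSet B → A = τ^[n] ⁻¹' B →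
      volume.real (Bᶜ ∩ {y : unitInterval | (y : ℝ) ≤ 1 / (2 * C)}) ≤ 2 * δ := by
  obtain ⟨m, w, hw, hwA⟩ := hτ.exists_cylinder_sdiff_le hAm hA
    (δ := ENNReal.ofReal δ) (by simpa using hδ)
  set J := branchCylinder τ a b w
  have hJ : MeasurableSet J := hτ.measurableSet_cylinder w
  obtain ⟨L, hL⟩ := hτ.exists_hasConcaveDistFun_cylinder w volume hasConcaveDistFun_volume
  have hM : ∀ n, ((volume.restrict J).map τ^[n]).real univ = volume.real J := fun n => by
    rw [map_measureReal_apply (hτ.measurable.iterate n) MeasurableSet.univ, preimage_univ,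
      measureReal_restrict_apply_univ]
  have hM0 : 0 < volume.real J := ENNReal.toReal_pos hw (measure_ne_top _ _)
  have hev := H _ L hL (by rwa [hM])
  obtain ⟨N, hN⟩ := eventually_atTop.1 hev
  filter_upwards [eventually_ge_atTop (m + N)] with n hn B hB hAB
  obtain ⟨k, rfl⟩ := Nat.exists_eq_add_of_le' (le_of_add_le_left hn)
  have hk := hN k (by omega)
  rw [Measure.map_map (hτ.measurable.iterate k) (hτ.measurable.iterate m), ← Function.iterate_add,
    hM, ← hM (k + m)] at hk
  have hle := ENNReal.toReal_mono (measure_ne_top _ _) (hk.smul_restrict_le hC Bᶜ)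
  rw [hM, Measure.smul_apply, smul_eq_mul, ENNReal.toReal_mul,
    ENNReal.toReal_ofReal (half_pos hM0).le, Measure.restrict_apply hB.compl,
    Measure.map_apply (hτ.measurable.iterate _) hB.compl, preimage_compl, ← hAB,
    Measure.restrict_apply hAm.compl, inter_comm Aᶜ, ← sdiff_eq] at hle
  have h2 := ENNReal.toReal_mono (ENNReal.mul_ne_top ENNReal.ofReal_ne_top (measure_ne_top _ _)) hwA
  rw [ENNReal.toReal_mul, ENNReal.toReal_ofReal hδ.le] at h2
  have h3 : volume.real J / 2 * volume.real (Bᶜ ∩ {y : unitInterval | (y : ℝ) ≤ 1 / (2 * C)})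
      ≤ δ * volume.real J := hle.trans h2
  nlinarith

/-- Sets of the tail `σ`-algebra are null or conull for Lebesgue measure. -/
theorem volume_tail {A : Set unitInterval}
    (hA : ∀ n : ℕ, ∃ B : Set unitInterval, MeasurableSet B ∧ A = τ^[n] ⁻¹' B) :
    volume A = 0 ∨ volume Aᶜ = 0 := by
  by_contra! hcon
  obtain ⟨C, hC, -, H⟩ := hτ.exists_hasConcaveDistFun_iterate
  have hAm : MeasurableSet A := by
    obtain ⟨B, hB, rfl⟩ := hA 0
    exact hB
  set e := 1 / (2 * C)
  have he : 0 < e := by positivity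
  have he1 : e ≤ 1 := (div_le_one (by positivity)).2 (by linarith)
  -- With `δ = e / 5` the two parts of `[0, e]` have measure at most `2 * e / 5` each, too little to
  -- cover it.
  obtain ⟨n, h1, h2⟩ := ((hτ.eventually_volume_compl_le hC H hAm hcon.1 (δ := e / 5)
    (by positivity)).and (hτ.eventually_volume_compl_le hC H hAm.compl hcon.2 (δ := e / 5)
    (by positivity))).exists
  obtain ⟨B, hB, hAB⟩ := hA n
  have h3 := h1 B hB hAB
  have h4 := h2 Bᶜ hB.compl (by rw [hAB, preimage_compl])
  have h5 : volume.real {y : unitInterval | (y : ℝ) ≤ e} = e := by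
    change distFun volume e = e
    rw [distFun_volume, min_eq_left he1, max_eq_right he.le]
  have h6 : {y : unitInterval | (y : ℝ) ≤ e} ⊆
      (Bᶜ ∩ {y : unitInterval | (y : ℝ) ≤ e}) ∪ (Bᶜᶜ ∩ {y | (y : ℝ) ≤ e}) := by
    rw [← union_inter_distrib_right, union_compl_self, univ_inter]
  have h7 := (measureReal_mono (μ := volume) h6).trans (measureReal_union_le _ _)
  rw [h5] at h7
  linarith

end IsPiecewiseConvexMap

/-! ### Existence of an invariant measure. -/

theorem hasSum_real_iUnion {α : Type*} [MeasurableSpace α] (μ : Measure α) [IsFiniteMeasure μ]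
    {f : ℕ → Set α} (hf : ∀ i, MeasurableSet (f i)) (hd : Pairwise (Function.onFun Disjoint f)) :
    HasSum (fun i => μ.real (f i)) (μ.real (⋃ i, f i)) := by
  have h := measure_iUnion hd hf (μ := μ)
  have hne : ∑' i, μ (f i) ≠ ⊤ := h ▸ measure_ne_top μ _
  have := ENNReal.hasSum_toReal hne
  rwa [← ENNReal.tsum_toReal_eq (ENNReal.ne_top_of_tsum_ne_top hne), ← h] at this

/-- Probability measures which are dominated by a finite measure have a setwise limit along
any ultrafilter. -/
theorem exists_tendsto_measureReal {α : Type*} [MeasurableSpace α] (u : Ultrafilter ℕ)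
    (A : ℕ → Measure α) [∀ n, IsProbabilityMeasure (A n)] (m : Measure α) [IsFiniteMeasure m]
    (K : ℝ) (hA : ∀ n s, (A n).real s ≤ K * m.real s) :
    ∃ μ : Measure α, IsProbabilityMeasure μ ∧
      ∀ s, MeasurableSet s → Tendsto (fun n => (A n).real s) u (𝓝 (μ.real s)) := by
  have hlim : ∀ s, ∃ l, Tendsto (fun n => (A n).real s) u (𝓝 l) := by
    intro s
    obtain ⟨l, -, hl⟩ := isCompact_Icc.ultrafilter_le_nhds
      (u.map fun n => (A n).real s)
      (le_principal_iff.2 (Filter.mem_map.2 <| univ_mem' fun n =>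
        (⟨measureReal_nonneg, measureReal_le_one⟩ : (A n).real s ∈ Icc (0 : ℝ) 1)))
    exact ⟨l, hl⟩
  choose l hl using hlim
  have hl0 : ∀ s, 0 ≤ l s := fun s => ge_of_tendsto' (hl s) fun n => measureReal_nonneg
  have hU : ∀ ⦃f : ℕ → Set α⦄, (∀ i, MeasurableSet (f i)) → Pairwise (Function.onFun Disjoint f) →
      ENNReal.ofReal (l (⋃ i, f i)) = ∑' i, ENNReal.ofReal (l (f i)) := by
    intro f hf hd
    -- Domination by `K * m` is what passes countable additivity to the limit.
    have hsm : Summable fun i => K * m.real (f i) := (hasSum_real_iUnion m hf hd).summable.mul_left K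
    have h1 : Tendsto (fun n => ∑' i, (A n).real (f i)) u (𝓝 (∑' i, l (f i))) :=
      tendsto_tsum_of_dominated_convergence hsm (fun i => hl (f i))
        (Eventually.of_forall fun n i => by
          rw [Real.norm_of_nonneg measureReal_nonneg]
          exact hA n (f i))
    have h2 : l (⋃ i, f i) = ∑' i, l (f i) := by
      refine tendsto_nhds_unique (hl _) (h1.congr fun n => ?_)
      exact (hasSum_real_iUnion (A n) hf hd).tsum_eq
    rw [h2, ENNReal.ofReal_tsum_of_nonneg fun i => hl0 _]
    exact hsm.of_nonneg_of_le (fun i => hl0 _) fun i => le_of_tendsto' (hl _) fun n => hA n _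
  have hempty : l ∅ = 0 := tendsto_nhds_unique (hl ∅) (by simp)
  have huniv : l univ = 1 := tendsto_nhds_unique (hl univ) (by simp)
  let μ : Measure α := Measure.ofMeasurable (fun s _ => ENNReal.ofReal (l s)) (by simp [hempty]) hU
  have hμ : ∀ s, MeasurableSet s → μ s = ENNReal.ofReal (l s) := fun s hs =>
    Measure.ofMeasurable_apply s hs
  refine ⟨μ, ⟨?_⟩, fun s hs => ?_⟩
  · rw [hμ _ MeasurableSet.univ, huniv, ENNReal.ofReal_one]
  · rw [measureReal_def, hμ s hs, ENNReal.toReal_ofReal (hl0 s)]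
    exact hl s

/-- The average of the first `n + 1` images of Lebesgue measure. -/
noncomputable def averageMeasure (τ : unitInterval → unitInterval) (n : ℕ) :
    Measure unitInterval :=
  ENNReal.ofReal (1 / (n + 1)) •
    ∑ k ∈ Finset.range (n + 1), (volume : Measure unitInterval).map τ^[k]

theorem averageMeasure_real {τ : unitInterval → unitInterval} (hτ : Measurable τ) (n : ℕ)
    {s : Set unitInterval} (hs : MeasurableSet s) :
    (averageMeasure τ n).real s
      = 1 / (n + 1) * ∑ k ∈ Finset.range (n + 1), volume.real (τ^[k] ⁻¹' s) := by
  have hn : (0 : ℝ) ≤ 1 / (n + 1) := by positivity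
  rw [measureReal_def, averageMeasure, Measure.smul_apply, smul_eq_mul, ENNReal.toReal_mul,
    ENNReal.toReal_ofReal hn, Measure.finsetSum_apply, ENNReal.toReal_sum]
  · congr 1
    refine Finset.sum_congr rfl fun k _ => ?_
    rw [Measure.map_apply (hτ.iterate k) hs]
    rfl
  · intro k _
    rw [Measure.map_apply (hτ.iterate k) hs]
    exact measure_ne_top _ _

theorem isProbabilityMeasure_averageMeasure {τ : unitInterval → unitInterval} (hτ : Measurable τ)
    (n : ℕ) : IsProbabilityMeasure (averageMeasure τ n) := by
  have h := averageMeasure_real hτ n MeasurableSet.univ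
  have hn : (n : ℝ) + 1 ≠ 0 := by positivity
  simp only [preimage_univ, probReal_univ, Finset.sum_const, Finset.card_range, nsmul_eq_mul,
    Nat.cast_add, Nat.cast_one, mul_one, one_div_mul_cancel hn] at h
  refine ⟨?_⟩
  rw [measureReal_def] at h
  rw [← ENNReal.toReal_eq_one_iff, h]

namespace IsPiecewiseConvexMap

variable {τ : unitInterval → unitInterval} {a b s : ℕ → ℝ} (hτ : IsPiecewiseConvexMap τ a b s)

include hτ

theorem exists_hasConcaveDistFun_averageMeasure :
    ∃ K, ∀ n, HasConcaveDistFun (averageMeasure τ n) K := by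
  obtain ⟨C, hC, H, -⟩ := hτ.exists_hasConcaveDistFun_iterate
  have hk : ∀ k, HasConcaveDistFun ((volume : Measure unitInterval).map τ^[k]) (1 + C) := fun k => by
    simpa using H volume 1 hasConcaveDistFun_volume k
  refine ⟨1 + C, fun n => ?_⟩
  have hn : (0 : ℝ) < n + 1 := by positivity
  have heq : distFun (averageMeasure τ n) = fun x => 1 / ((n : ℝ) + 1) *
      ∑ k ∈ Finset.range (n + 1), distFun (volume.map τ^[k]) x := by
    funext x
    rw [distFun, averageMeasure_real hτ.measurable n (measurableSet_coe_le x)]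
    congr 1
    refine Finset.sum_congr rfl fun k _ => ?_
    rw [distFun, map_measureReal_apply (hτ.measurable.iterate k) (measurableSet_coe_le x)]
  constructor
  · rw [heq]
    refine ⟨convex_Ici 0, fun x hx y hy t r ht hr htr => ?_⟩
    have := Finset.sum_le_sum fun k (_ : k ∈ Finset.range (n + 1)) =>
      (hk k).concaveOn.2 hx hy ht hr htr
    simp only [smul_eq_mul, Finset.sum_add_distrib, ← Finset.mul_sum] at this ⊢
    rw [mul_left_comm t, mul_left_comm r, ← mul_add]
    exact mul_le_mul_of_nonneg_left this (by positivity)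
  · intro x hx
    rw [heq]
    have := Finset.sum_le_sum fun k (_ : k ∈ Finset.range (n + 1)) => (hk k).le_mul x hx
    rw [Finset.sum_const, Finset.card_range, nsmul_eq_mul] at this
    push_cast at this
    rw [one_div, inv_mul_le_iff₀ hn]
    exact this

/-- Concavity and the uniform bound are pointwise inequalities between values of the distribution
function, so they survive the setwise limit of the averages. -/
theorem exists_isNormalizedACIM :
    ∃ (μ : Measure unitInterval) (K : ℝ), IsNormalizedACIM τ μ ∧ HasConcaveDistFun μ K := by
  obtain ⟨K, hK⟩ := hτ.exists_hasConcaveDistFun_averageMeasure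
  have hprob := isProbabilityMeasure_averageMeasure hτ.measurable
  obtain ⟨μ, hμ, hlim⟩ := exists_tendsto_measureReal (hyperfilter ℕ) (averageMeasure τ) volume K
    fun n s => (hK n).real_le s
  have hF : ∀ x, Tendsto (fun n => distFun (averageMeasure τ n) x) (hyperfilter ℕ)
      (𝓝 (distFun μ x)) := fun x => hlim _ (measurableSet_coe_le x)
  have hμK : HasConcaveDistFun μ K := by
    refine ⟨⟨convex_Ici 0, fun x hx y hy t r ht hr htr => ?_⟩, fun x hx => ?_⟩
    · exact le_of_tendsto_of_tendsto' (((hF x).const_smul t).add ((hF y).const_smul r)) (hF _)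
        fun n => (hK n).concaveOn.2 hx hy ht hr htr
    · exact le_of_tendsto' (hF x) fun n => (hK n).le_mul x hx
  refine ⟨μ, K, ⟨hμ, hμK.absolutelyContinuous, hτ.measurable, ?_⟩, hμK⟩
  ext B hB
  rw [Measure.map_apply hτ.measurable hB, ← measureReal_eq_measureReal_iff]
  -- The difference telescopes to two terms of size at most `1`, divided by `n + 1`.
  have hdiff : Tendsto (fun n => (averageMeasure τ n).real (τ ⁻¹' B) - (averageMeasure τ n).real B)
      (hyperfilter ℕ) (𝓝 0) := by
    have h0 : Tendsto (fun n : ℕ => 1 / ((n : ℝ) + 1)) (hyperfilter ℕ) (𝓝 0) :=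
      tendsto_one_div_add_atTop_nhds_zero_nat.mono_left Nat.hyperfilter_le_atTop
    refine squeeze_zero_norm (fun n => ?_) h0
    have hn : (0 : ℝ) < 1 / ((n : ℝ) + 1) := by positivity
    have hpre : ∀ k, τ^[k] ⁻¹' (τ ⁻¹' B) = τ^[k + 1] ⁻¹' B := fun k => by
      rw [Function.iterate_succ']
      rfl
    rw [averageMeasure_real hτ.measurable n (hτ.measurable hB),
      averageMeasure_real hτ.measurable n hB, ← mul_sub, ← Finset.sum_sub_distrib]
    simp only [hpre]
    rw [Finset.sum_range_sub fun k => volume.real (τ^[k] ⁻¹' B), norm_mul,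
      Real.norm_of_nonneg hn.le]
    refine mul_le_of_le_one_right hn.le ?_
    rw [Real.norm_eq_abs, abs_le]
    have h1 := measureReal_le_one (μ := volume) (s := τ^[n + 1] ⁻¹' B)
    have h2 := measureReal_le_one (μ := volume) (s := τ^[0] ⁻¹' B)
    have h3 := measureReal_nonneg (μ := volume) (s := τ^[n + 1] ⁻¹' B)
    have h4 := measureReal_nonneg (μ := volume) (s := τ^[0] ⁻¹' B)
    constructor <;> linarith
  exact sub_eq_zero.1 (tendsto_nhds_unique
    ((hlim _ (hτ.measurable hB)).sub (hlim _ hB)) hdiff)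

/-! ### Exactness, ergodicity and uniqueness. -/

theorem isExactSystem {μ : Measure unitInterval} (hμ : IsNormalizedACIM τ μ) :
    IsExactSystem τ μ := by
  have := hμ.isProbabilityMeasure
  refine ⟨hμ.isProbabilityMeasure, hμ.measurePreserving, fun A hA => ?_⟩
  obtain ⟨B, hB, rfl⟩ := hA 0
  rcases hτ.volume_tail hA with h | h
  · exact Or.inl (hμ.absolutelyContinuous h)
  · exact Or.inr ((prob_compl_eq_zero_iff hB).1 (hμ.absolutelyContinuous h))

theorem ergodic {μ : Measure unitInterval} (hμ : IsNormalizedACIM τ μ) : Ergodic τ μ := by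
  refine ⟨hμ.measurePreserving, ⟨fun A hA hinv => ?_⟩⟩
  have := hμ.isProbabilityMeasure
  have hn : ∀ n, τ^[n] ⁻¹' A = A := fun n => by
    rw [congrFun preimage_iterate_eq A]
    exact Function.iterate_fixed hinv n
  rw [eventuallyConst_set']
  rcases hτ.volume_tail fun n => ⟨A, hA, (hn n).symm⟩ with h | h
  · exact Or.inl (ae_eq_empty.2 (hμ.absolutelyContinuous h))
  · exact Or.inr (eventuallyEq_univ.2 (hμ.absolutelyContinuous h))

/-- The mean of the two measures is again such a measure, hence ergodic. Each of the two is
absolutely continuous with respect to it, so equals it. -/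
theorem isNormalizedACIM_unique {μ ν : Measure unitInterval} (hμ : IsNormalizedACIM τ μ)
    (hν : IsNormalizedACIM τ ν) : μ = ν := by
  have := hμ.isProbabilityMeasure
  have := hν.isProbabilityMeasure
  have hprob : IsProbabilityMeasure ((2⁻¹ : ENNReal) • (μ + ν)) := by
    refine ⟨?_⟩
    rw [Measure.smul_apply, Measure.add_apply, measure_univ, measure_univ, one_add_one_eq_two,
      smul_eq_mul, ENNReal.inv_mul_cancel two_ne_zero ENNReal.ofNat_ne_top]
  have hmp : MeasurePreserving τ ((2⁻¹ : ENNReal) • (μ + ν)) ((2⁻¹ : ENNReal) • (μ + ν)) := by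
    refine ⟨hτ.measurable, ?_⟩
    rw [Measure.map_smul, Measure.map_add _ _ hτ.measurable, hμ.measurePreserving.map_eq,
      hν.measurePreserving.map_eq]
  have hac : (2⁻¹ : ENNReal) • (μ + ν) ≪ volume :=
    Measure.smul_absolutelyContinuous.trans
      (Measure.AbsolutelyContinuous.add_left hμ.absolutelyContinuous hν.absolutelyContinuous)
  have herg := hτ.ergodic ⟨hprob, hac, hmp⟩
  have hle : μ + ν ≪ (2⁻¹ : ENNReal) • (μ + ν) :=
    Measure.absolutelyContinuous_smul (by simp)
  rw [herg.eq_of_absolutelyContinuous hμ.measurePreserving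
      ((Measure.absolutelyContinuous_of_le (Measure.le_add_right le_rfl)).trans hle),
    ← herg.eq_of_absolutelyContinuous hν.measurePreserving
      ((Measure.absolutelyContinuous_of_le (Measure.le_add_left le_rfl)).trans hle)]

end IsPiecewiseConvexMap

/-! ### The monotone density. -/

/-- A probability measure with concave distribution function has a bounded non-increasing
density. -/
theorem HasConcaveDistFun.exists_antitone_density {μ : Measure unitInterval}
    [IsProbabilityMeasure μ] {L : ℝ} (hμ : HasConcaveDistFun μ L) :
    ∃ h : unitInterval → ℝ,
      (μ.rnDeriv volume =ᵐ[volume] fun x => ENNReal.ofReal (h x)) ∧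
      (∀ x, 0 ≤ h x) ∧ (∃ C : ℝ, ∀ x, h x ≤ C) ∧ Antitone h := by
  set ν := μ.map ((↑) : unitInterval → ℝ)
  have hν : IsProbabilityMeasure ν :=
    Measure.isProbabilityMeasure_map measurable_subtype_coe.aemeasurable
  have hvol : (volume : Measure unitInterval).map ((↑) : unitInterval → ℝ)
      = volume.restrict unitInterval := unitInterval.measurePreserving_coe.map_eq
  have hac' : ν ≪ volume.restrict unitInterval :=
    hvol ▸ hμ.absolutelyContinuous.map measurable_subtype_coe
  have hac : ν ≪ volume := hac'.trans Measure.absolutelyContinuous_restrict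
  have hcdf : ∀ x, ProbabilityTheory.cdf ν x = distFun μ x := fun x => by
    rw [ProbabilityTheory.cdf_eq_real, map_measureReal_apply measurable_subtype_coe
      measurableSet_Iic]
    rfl
  set r := ν.rnDeriv volume
  have hderiv : ∀ᵐ x : ℝ, HasDerivAt (distFun μ) (r x).toReal x := by
    have := (ProbabilityTheory.cdf ν).ae_hasDerivAt
    rwa [ProbabilityTheory.measure_cdf, show ⇑(ProbabilityTheory.cdf ν) = distFun μ from
      funext hcdf] at this
  -- On `G`, almost all of the positive axis, the density is the derivative of a concave function,
  -- hence non-increasing and at most `L`. It is then extended monotonically and clipped to `[0,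
  -- L]`, which does not change it on `G`.
  set G := {x : ℝ | 0 < x ∧ HasDerivAt (distFun μ) (r x).toReal x}
  have hle : ∀ x ∈ G, (r x).toReal ≤ L := by
    rintro x ⟨hx, hd⟩
    have := hμ.concaveOn.le_slope_of_hasDerivAt (mem_Ici.2 le_rfl) (mem_Ici.2 hx.le) hx hd
    refine this.trans ?_
    rw [slope_def_field, hμ.apply_zero, sub_zero, sub_zero, div_le_iff₀ hx]
    exact hμ.le_mul x hx.le
  have hanti : AntitoneOn (fun x => (r x).toReal) G := by
    rintro x ⟨hx, hdx⟩ y ⟨hy, hdy⟩ hxy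
    rcases hxy.eq_or_lt with rfl | hxy
    · exact le_rfl
    · exact (hμ.concaveOn.le_slope_of_hasDerivAt (mem_Ici.2 hx.le) (mem_Ici.2 hy.le) hxy hdy).trans
        (hμ.concaveOn.slope_le_of_hasDerivAt (mem_Ici.2 hx.le) (mem_Ici.2 hy.le) hxy hdx)
  obtain ⟨g, hg, hgr⟩ := hanti.exists_antitone_extension
    ⟨0, by rintro _ ⟨x, -, rfl⟩; exact ENNReal.toReal_nonneg⟩
    ⟨L, by rintro _ ⟨x, hx, rfl⟩; exact hle x hx⟩
  refine ⟨fun x => max 0 (min L (g x)), ?_, fun x => le_max_left _ _,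
    ⟨L, fun x => max_le hμ.nonneg (min_le_left _ _)⟩, fun x y hxy =>
      max_le_max le_rfl (min_le_min le_rfl (hg hxy))⟩
  have hr : ν.rnDeriv (volume.restrict unitInterval) =ᵐ[volume.restrict unitInterval] r := by
    have h1 : ν = (volume.restrict unitInterval).withDensity r := by
      rw [← restrict_withDensity measurableSet_Icc, Measure.withDensity_rnDeriv_eq _ _ hac]
      refine (Measure.restrict_eq_self_of_ae_mem ?_).symm
      exact (ae_map_iff measurable_subtype_coe.aemeasurable measurableSet_Icc).2
        (Eventually.of_forall fun y => y.2)
    conv_lhs => rw [h1]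
    exact Measure.rnDeriv_withDensity _ (Measure.measurable_rnDeriv _ _)
  have hfin : ∀ᵐ x ∂volume.restrict unitInterval, r x < ⊤ :=
    ae_restrict_of_ae (Measure.rnDeriv_lt_top ν volume)
  have hpos : ∀ᵐ x : unitInterval, (0 : ℝ) < x := by
    have : ∀ᵐ x : unitInterval, x ≠ 0 := by simp [ae_iff]
    filter_upwards [this] with x hx using unitInterval.pos_iff_ne_zero.2 hx
  have hqmp := unitInterval.measurePreserving_coe.quasiMeasurePreserving
  filter_upwards [unitInterval.measurableEmbedding_coe.rnDeriv_map μ volume, hqmp.ae hr,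
    hqmp.ae hfin, hqmp.ae (ae_restrict_of_ae hderiv), hpos] with x h1 h2 h3 h4 h5
  rw [hvol] at h1
  rw [← h1, h2, ← hgr ⟨h5, h4⟩, min_eq_right (hle _ ⟨h5, h4⟩), max_eq_right ENNReal.toReal_nonneg,
    ENNReal.ofReal_toReal h3.ne]

theorem theorem2p2p9 (τ : unitInterval → unitInterval) (hτ : τ ∈ classT) :
    (∃! μ : Measure unitInterval, IsNormalizedACIM τ μ) ∧
    ∀ μ : Measure unitInterval, IsNormalizedACIM τ μ →
      IsExactSystem τ μ ∧
      ∃ h : unitInterval → ℝ,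
        (μ.rnDeriv volume =ᵐ[volume] fun x => ENNReal.ofReal (h x)) ∧
        (∀ x, 0 ≤ h x) ∧ (∃ C : ℝ, ∀ x, h x ≤ C) ∧ Antitone h := by
  obtain ⟨a, b, s, hτ⟩ := hτ
  obtain ⟨μ₀, K, hμ₀, hK⟩ := hτ.exists_isNormalizedACIM
  refine ⟨⟨μ₀, hμ₀, fun μ hμ => hτ.isNormalizedACIM_unique hμ hμ₀⟩, fun μ hμ =>
    ⟨hτ.isExactSystem hμ, ?_⟩⟩
  obtain rfl := hτ.isNormalizedACIM_unique hμ hμ₀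
  have := hμ.isProbabilityMeasure
  exact hK.exists_antitone_density
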